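/- A real polynomial is called a real Morse polynomial if it is monic, all roots of its derivative (critical points) are real and simple, and its critical values are pairwise different. For a real polynomial, enumerate its real critical points $x_1<\dots<x_n$ and its distinct critical values in increasing order; its passport is the sequence $(a_1,\dots,a_n)$, where $a_i$ is the number of the critical value at $x_i$ (equal critical values have equal numbers). A degenerate snake of order 4 is the plot of a monic real polynomial of degree 5 with four real critical points and exactly three critical values; it is recorded by its passport. For $(b,c)\in\mathbb R^2$ put $$q=x^3+3x^2+bx+c,\qquad p=x^5+\tfrac{15}{4}x^4+\tfrac{5b}{3}x^3+\tfrac{5c}{2}x^2,$$ so that $p'=5xq$, and $$dq=54bc-108c-4b^3+9b^2-27c^2,$$ $$g=128b^3-1998b^2-216c^2+1512bc+3645b-729c,$$ $$h=640b^3-1350b^2+5832c^2-9720bc+18225c.$$ Let $\Omega$ be the set of $(b,c)$ for which $q$ has three pairwise different negative roots, and let $O=(0,0)$, $A=(3,1)$, $B=(9/4,0)$, $D=(135/64,0)$, $E=(45/16,25/32)$. A curvilinear triangle $UVW$ is a bounded connected open set whose boundary is the union of three simple arcs $UV$, $VW$, $WU$ that meet only at the common vertices. Then: 1. For every real Morse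 polynomial $P$ of degree 5 there are $(b,c)\in\Omega$ and reals $k>0$, $l$, $m$ with $P(kx+l)=k^5p(x)+m$; here $p$ is a Morse polynomial with the same passport as $P$. 2. $dq$ is the discriminant of $q$, and $\Omega=\{b>0,\ c>0,\ dq>0\}$. The set $\Omega$ is a curvilinear triangle $OAB$, whose side $OB$ is a straight segment and whose sides $OA$ and $AB$ together form the curve $\{dq=0,\ b\ge 0,\ c\ge 0\}$; the point $E$ divides the side $AB$ into arcs $AE$ and $EB$, and the point $D$ lies on $OB$. 3. For $(b,c)\in\Omega$: $g=0$ if and only if $p$ takes equal values at two different roots of $q$; $h=0$ if and only if $p$ vanishes at some root of $q$. For $b,c>0$ the polynomial $p$ is Morse if and only if $(b,c)\in\Omega$, $g\ne0$ and $h\ne0$. 4. The curves $g=0$ and $h=0$ have exactly one common point $F\approx(2.73,\,0.72)$ in $\Omega$ (coordinates up to an error less than $0.005$). There are simple arcs $AF$, $FD$, $OF$, $FE$, $ED$ such that $\{g=0\}\cap\Omega=(AF\cup FD)\setminus\{A,D\}$ and $\{h=0\}\cap\Omega=(OF\cup FE\cup ED)\setminus\{O,E,D\}$. These arcs divide $\Omega$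 into five curvilinear triangles: $\Omega\setminus(\{g=0\}\cup\{h=0\})$ is the disjoint union of curvilinear triangles $OAF$, $AEF$, $ODF$, $DEF$, $BDE$, whose sides are the arcs named above and the segments $OD$, $BD$. 5. For $(b,c)\in\Omega$, the polynomial $p$ is a Morse polynomial with passport $(4,2,3,1)$, $(3,2,4,1)$, $(4,1,3,2)$, $(3,1,4,2)$, $(2,1,4,3)$ if and only if $(b,c)$ lies in $OAF$, $AEF$, $ODF$, $DEF$, $BDE$, respectively. These five passports are exactly the passports of real Morse polynomials of degree 5. 6. For $(b,c)\in\Omega$, the plot of $p$ is a degenerate snake with passport $(3,2,3,1)$, $(3,1,2,1)$, $(3,1,3,2)$, $(2,1,3,1)$, $(2,1,3,2)$ if and only if $(b,c)$ lies on the arc $AF$, $OF$, $FD$, $FE$, $ED$, respectively, endpoints excluded. These five passports are exactly those of the degenerate snakes of order 4. -/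

import Mathlib

open Polynomial

namespace MorseQuintic

noncomputable section

/-- The real critical points of a real polynomial (the real roots of its derivative). -/
def criticalPoints (P : ℝ[X]) : Finset ℝ := P.derivative.roots.toFinset

/-- The values of a polynomial at its real critical points. -/
def criticalValues (P : ℝ[X]) : Finset ℝ := (criticalPoints P).image (fun x => P.eval x)

/-- The number of the critical value `v` when the distinct critical values are enumerated
`1, 2, 3, …` in increasing order. -/
def valueNumber (P : ℝ[X]) (v : ℝ) : ℕ := ((criticalValues P).filter (fun w => w ≤ v)).card

/-- The passport: the critical points are listed in increasing order, and the `i`-th entry is the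
number of the critical value at the `i`-th critical point. For a polynomial with coinciding critical
values, equal values get equal numbers, so that the same list records a degenerate snake. -/
def passport (P : ℝ[X]) : List ℕ :=
  ((criticalPoints P).sort (fun x y => x ≤ y)).map (fun x => valueNumber P (P.eval x))

/-- Real Morse polynomials: monic, all roots of the derivative are real and simple, and the critical
values are pairwise different. -/
def IsMorse (P : ℝ[X]) : Prop :=
  P.Monic ∧ P.derivative.Splits ∧ P.derivative.roots.Nodup ∧
    Set.InjOn (fun x => P.eval x) {x | P.derivative.IsRoot x}

/-- Monic quintics whose plot is a degenerate snake: four real critical points, but only three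
critical values. -/
def IsDegenerateSnake (P : ℝ[X]) : Prop :=
  P.Monic ∧ P.natDegree = 5 ∧ (criticalPoints P).card = 4 ∧ (criticalValues P).card = 3

/-- `q = x³ + 3x² + bx + c`, where `u = (b, c)`. -/
def q (u : ℝ × ℝ) : ℝ[X] := X ^ 3 + C 3 * X ^ 2 + C u.1 * X + C u.2

/-- `p = x⁵ + (15/4)x⁴ + (5b/3)x³ + (5c/2)x²`, where `u = (b, c)`. -/
def p (u : ℝ × ℝ) : ℝ[X] :=
  X ^ 5 + C (15 / 4) * X ^ 4 + C (5 * u.1 / 3) * X ^ 3 + C (5 * u.2 / 2) * X ^ 2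

/-- The polynomial defining the discriminant curve. -/
def dq (u : ℝ × ℝ) : ℝ :=
  54 * u.1 * u.2 - 108 * u.2 - 4 * u.1 ^ 3 + 9 * u.1 ^ 2 - 27 * u.2 ^ 2

/-- The polynomial defining the curve of equal critical values at roots of `q`. -/
def g (u : ℝ × ℝ) : ℝ :=
  128 * u.1 ^ 3 - 1998 * u.1 ^ 2 - 216 * u.2 ^ 2 + 1512 * u.1 * u.2 + 3645 * u.1 - 729 * u.2

/-- The polynomial defining the curve of vanishing critical values at roots of `q`. -/
def h (u : ℝ × ℝ) : ℝ :=
  640 * u.1 ^ 3 - 1350 * u.1 ^ 2 + 5832 * u.2 ^ 2 - 9720 * u.1 * u.2 + 18225 * u.2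

/-- The parameters for which `q` has three pairwise different negative roots. -/
def region : Set (ℝ × ℝ) :=
  {u | ∃ r s t : ℝ, r < s ∧ s < t ∧ t < 0 ∧ q u = (X - C r) * (X - C s) * (X - C t)}

def ptO : ℝ × ℝ := (0, 0)
def ptA : ℝ × ℝ := (3, 1)
def ptB : ℝ × ℝ := (9 / 4, 0)
def ptD : ℝ × ℝ := (135 / 64, 0)
def ptE : ℝ × ℝ := (45 / 16, 25 / 32)

/-- `γ` is a simple (non-self-intersecting) arc in the plane with endpoints `Y` and `Z`. -/
def IsSimpleArc (γ : Set (ℝ × ℝ)) (Y Z : ℝ × ℝ) : Prop :=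
  ∃ f : Path Y Z, Function.Injective f ∧ Set.range f = γ

/-- `T` is the (open) curvilinear triangle with vertices `U, V, W` and sides `UV`, `VW`, `WU`: the
sides are simple arcs that meet only at the common vertices, and `T` is a bounded domain whose
boundary is the closed curve formed by the three sides (hence `T` is the interior of this curve). -/
def IsCurvilinearTriangle (T : Set (ℝ × ℝ)) (U V W : ℝ × ℝ) (UV VW WU : Set (ℝ × ℝ)) : Prop :=
  IsSimpleArc UV U V ∧ IsSimpleArc VW V W ∧ IsSimpleArc WU W U ∧
  UV ∩ VW = {V} ∧ VW ∩ WU = {W} ∧ WU ∩ UV = {U} ∧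
  IsOpen T ∧ IsConnected T ∧ Bornology.IsBounded T ∧ frontier T = UV ∪ VW ∪ WU

end

end MorseQuintic

/-!
For a monic quintic `P` with four critical points, two of which are `y < z`, the difference
`P(y) - P(z)` is a positive multiple of a quadratic form in the critical points (`conic`). Hence the
passport of `p` is decided by the signs of three such forms in the roots `r < s < t` of `q`: those
of the pairs `(r, t)`, `(s, 0)` and `(r, 0)`, the other three comparisons being forced. Up to a
constant, `g` and `h` are the products of the forms of the pairs among `r`, `s`, `t` and of the
pairs with `0`.

The proportions of the gaps `s - r`, `t - s`, `-t` parametrise the closed triangle `OAB` by the unit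
square, one side of which is collapsed to `B`. On a vertical line of the square each of the three
forms is a quadratic polynomial with a single zero in `[0, 1)`, so that `g = 0` is the graph of one
function and `h = 0` the union of the graphs of two. The reflection `l ↦ 1 - l` exchanges the graphs
of the pairs `(r, t)` and `(s, 0)`, which therefore cross over `l = 1 / 2`, at the point `F`, and
nowhere else; the graph of `(r, 0)` lies above both. The five triangles are the regions between
these graphs, and the signs of the three forms on them give the passports.
-/

namespace MorseQuintic

section Ranks

variable {α β : Type*} [LinearOrder α] [LinearOrder β]

/-- The ranks of the entries of a list among its distinct entries, in increasing order and counted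
from `1`; equal entries get equal ranks. The passport of a polynomial is the list of ranks of its
values at the critical points. -/
def ranks (l : List α) : List ℕ :=
  l.map fun v => (l.toFinset.filter (· ≤ v)).card

theorem ranks_map {f : α → β} (hf : StrictMono f) (l : List α) : ranks (l.map f) = ranks l := by
  have toFinset_map : (l.map f).toFinset = l.toFinset.image f := by ext; simp
  have card_filter_le (v : α) : ((l.map f).toFinset.filter (· ≤ f v)).card =
      (l.toFinset.filter (· ≤ v)).card := by
    rw [toFinset_map, Finset.filter_image, Finset.card_image_of_injective _ hf.injective]
    simp only [hf.le_iff_le]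
  simp only [ranks, List.map_map, Function.comp_def, card_filter_le]

theorem isGreatest_ranks {l : List α} (hl : l ≠ []) :
    IsGreatest {n | n ∈ ranks l} l.toFinset.card := by
  obtain ⟨v, hv, hmax⟩ := l.toFinset.exists_max_image id (by simpa using hl)
  refine ⟨List.mem_map.2 ⟨v, by simpa using hv, ?_⟩, fun n hn => ?_⟩
  · rw [Finset.filter_true_of_mem (by simpa using hmax)]
  · obtain ⟨w, -, rfl⟩ := List.mem_map.1 hn
    exact Finset.card_filter_le _ _

theorem ranks_cases_of_snake {a b c d : α} (hab : b < a) (hbc : b < c) (hcd : d < c) :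
    (d < b ∧ c < a ∧ ranks [a, b, c, d] = [4, 2, 3, 1]) ∨
    (d < b ∧ a = c ∧ ranks [a, b, c, d] = [3, 2, 3, 1]) ∨
    (d < b ∧ a < c ∧ ranks [a, b, c, d] = [3, 2, 4, 1]) ∨
    (b = d ∧ c < a ∧ ranks [a, b, c, d] = [3, 1, 2, 1]) ∨
    (b = d ∧ a = c ∧ ranks [a, b, c, d] = [2, 1, 2, 1]) ∨
    (b = d ∧ a < c ∧ ranks [a, b, c, d] = [2, 1, 3, 1]) ∨
    (b < d ∧ c < a ∧ ranks [a, b, c, d] = [4, 1, 3, 2]) ∨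
    (b < d ∧ a = c ∧ ranks [a, b, c, d] = [3, 1, 3, 2]) ∨
    (b < d ∧ d < a ∧ a < c ∧ ranks [a, b, c, d] = [3, 1, 4, 2]) ∨
    (a = d ∧ ranks [a, b, c, d] = [2, 1, 3, 2]) ∨
    (a < d ∧ ranks [a, b, c, d] = [2, 1, 4, 3]) := by
  rcases lt_trichotomy b d with hbd | hbd | hbd <;>
    rcases lt_trichotomy a c with hac | hac | hac <;>
    rcases lt_trichotomy a d with had | had | had <;>
    first
    | order
    | simp [ranks, Finset.filter_insert, Finset.filter_singleton, not_le_of_gt, le_of_lt, ne_of_gt,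
        ne_of_lt, *]

end Ranks

theorem criticalValues_eq_toFinset {P : ℝ[X]} {l : List ℝ}
    (hl : (criticalPoints P).sort (fun x y => x ≤ y) = l) :
    criticalValues P = (l.map P.eval).toFinset := by
  ext; simp [criticalValues, ← hl]

theorem passport_eq_ranks {P : ℝ[X]} {l : List ℝ}
    (hl : (criticalPoints P).sort (fun x y => x ≤ y) = l) :
    passport P = ranks (l.map P.eval) := by
  simp only [passport, valueNumber, ranks, hl, criticalValues_eq_toFinset hl, List.map_map,
    Function.comp_def]

theorem isGreatest_passport {P : ℝ[X]} (hP : (criticalPoints P).Nonempty) :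
    IsGreatest {n | n ∈ passport P} (criticalValues P).card := by
  rw [passport_eq_ranks rfl, criticalValues_eq_toFinset rfl]
  exact isGreatest_ranks (by simpa [← List.length_eq_zero_iff] using hP.ne_empty)

section Affine

variable {P : ℝ[X]}

theorem mem_criticalPoints {x : ℝ} :
    x ∈ criticalPoints P ↔ derivative P ≠ 0 ∧ (derivative P).eval x = 0 := by
  rw [criticalPoints, Multiset.mem_toFinset, mem_roots']
  rfl

theorem passport_C_mul_add_C {a : ℝ} (ha : 0 < a) (m : ℝ) :
    passport (C a * P + C m) = passport P := by
  have hcrit : criticalPoints (C a * P + C m) = criticalPoints P := by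
    simp only [criticalPoints, derivative_add, derivative_C_mul, derivative_C, add_zero,
      roots_C_mul _ ha.ne']
  have hmono : StrictMono fun v : ℝ => a * v + m := fun v w hvw => by
    simp only
    gcongr
  rw [passport_eq_ranks (P := P) rfl, ← ranks_map hmono, passport_eq_ranks rfl, hcrit]
  simp [Function.comp_def]

theorem passport_comp_C_mul_X_add_C {k : ℝ} (hk : 0 < k) (l : ℝ) :
    passport (P.comp (C k * X + C l)) = passport P := by
  have hmono : StrictMono fun x : ℝ => k * x + l := fun x y hxy => by
    simp only
    gcongr
  obtain ⟨e, he⟩ : ∃ e : ℝ ↪ ℝ, ∀ x, e x = k * x + l := ⟨⟨_, hmono.injective⟩, fun _ => rfl⟩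
  have hzero : (derivative P).comp (C k * X + C l) = 0 ↔ derivative P = 0 :=
    comp_eq_zero_iff.trans <| or_iff_left fun h => hk.ne' <| by
      simpa using congrArg derivative h.2
  have hcrit : (criticalPoints (P.comp (C k * X + C l))).map e = criticalPoints P := by
    ext y
    simp only [Finset.mem_map, mem_criticalPoints, derivative_comp, he]
    constructor
    · rintro ⟨x, hx, rfl⟩
      simpa [hk.ne', hzero, -derivative_eq_zero] using hx
    · intro hy
      refine ⟨(y - l) / k, ?_, by field_simp; ring⟩
      simpa [hk.ne', hzero, mul_div_cancel₀ _ hk.ne', -derivative_eq_zero] using hy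
  rw [passport_eq_ranks rfl, passport_eq_ranks rfl, ← hcrit, ← StrictMonoOn.map_finsetSort,
    List.map_map]
  · simp [Function.comp_def, he]
  · exact StrictMono.strictMonoOn (fun x y hxy => by simpa only [he] using hmono hxy) _

end Affine

theorem natDegree_ne_zero_of_isMorse {P : ℝ[X]} (hP : IsMorse P) : P.natDegree ≠ 0 := by
  intro h0
  obtain rfl := hP.1.natDegree_eq_zero.1 h0
  exact zero_ne_one (α := ℝ) (hP.2.2.2 (by simp) (by simp) (by simp))

theorem isMorse_iff {P : ℝ[X]} : IsMorse P ↔ P.Monic ∧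
    (criticalPoints P).card + 1 = P.natDegree ∧
      (criticalValues P).card = (criticalPoints P).card := by
  have splits_and_nodup_iff (h0 : P.natDegree ≠ 0) :
      (derivative P).Splits ∧ (derivative P).roots.Nodup ↔
        (criticalPoints P).card + 1 = P.natDegree := by
    have h_le := Multiset.toFinset_card_le (derivative P).roots
    have h_roots := card_roots' (derivative P)
    rw [natDegree_derivative] at h_roots
    rw [splits_iff_card_roots, natDegree_derivative, ← Multiset.toFinset_card_eq_card_iff_nodup,
      criticalPoints]
    omega
  have injOn_iff (h0 : P.natDegree ≠ 0) :
      Set.InjOn (fun x => P.eval x) {x | (derivative P).IsRoot x} ↔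
        (criticalValues P).card = (criticalPoints P).card := by
    have setOf_isRoot : {x | (derivative P).IsRoot x} = (criticalPoints P : Set ℝ) := by
      ext x
      simp [mem_criticalPoints, h0]
    rw [criticalValues, Finset.card_image_iff, setOf_isRoot]
  constructor
  · intro hP
    have h0 := natDegree_ne_zero_of_isMorse hP
    exact ⟨hP.1, (splits_and_nodup_iff h0).1 ⟨hP.2.1, hP.2.2.1⟩, (injOn_iff h0).1 hP.2.2.2⟩
  · rintro ⟨hmonic, hcard, hval⟩
    have h0 : P.natDegree ≠ 0 := by omega
    obtain ⟨hsplits, hnodup⟩ := (splits_and_nodup_iff h0).2 hcard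
    exact ⟨hmonic, hsplits, hnodup, (injOn_iff h0).2 hval⟩

theorem derivative_eq_C_mul_prod {P : ℝ[X]} (hP : P.Monic)
    (hc : (criticalPoints P).card + 1 = P.natDegree) :
    derivative P = C (P.natDegree : ℝ) * ∏ x ∈ criticalPoints P, (X - C x) := by
  have hlead : (derivative P).leadingCoeff = P.natDegree := by
    rw [leadingCoeff, natDegree_derivative, coeff_derivative, ← hc, Nat.add_sub_cancel, hc,
      coeff_natDegree, hP, one_mul]
    exact_mod_cast hc
  have h_le := Multiset.toFinset_card_le (derivative P).roots
  have h_roots := card_roots' (derivative P)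
  rw [natDegree_derivative] at h_roots
  rw [criticalPoints] at hc
  have hnodup : (derivative P).roots.Nodup := Multiset.toFinset_card_eq_card_iff_nodup.1 (by omega)
  have hsplits : (derivative P).Splits :=
    splits_iff_card_roots.2 (by rw [natDegree_derivative]; omega)
  rw [hsplits.eq_prod_roots, hlead, criticalPoints, Finset.prod_eq_multiset_prod,
    Multiset.toFinset_val, Multiset.dedup_eq_self.2 hnodup]

/-- The critical points of the quintic `P` are `x₁ < x₂ < x₃ < x₄`, and `P` is monic. -/
structure HasOrderedCriticalPoints (P : ℝ[X]) (x₁ x₂ x₃ x₄ : ℝ) : Prop where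
  lt₁₂ : x₁ < x₂
  lt₂₃ : x₂ < x₃
  lt₃₄ : x₃ < x₄
  derivative_eq : derivative P = C 5 * ((X - C x₁) * (X - C x₂) * (X - C x₃) * (X - C x₄))

theorem exists_hasOrderedCriticalPoints {P : ℝ[X]} (hP : P.Monic) (h5 : P.natDegree = 5)
    (hc : (criticalPoints P).card = 4) : ∃ x₁ x₂ x₃ x₄, HasOrderedCriticalPoints P x₁ x₂ x₃ x₄ := by
  obtain ⟨x₁, x₂, x₃, x₄, hx⟩ := List.length_eq_four.1
    ((Finset.length_sort (fun x y : ℝ => x ≤ y)).trans hc)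
  have hlt := (Finset.sortedLT_sort (criticalPoints P)).pairwise
  have hd := derivative_eq_C_mul_prod hP (by rw [hc, h5])
  rw [hx] at hlt
  rw [← Finset.sort_toFinset (s := criticalPoints P) (fun x y => x ≤ y),
    List.prod_toFinset _ (Finset.sort_nodup _ _), hx, h5] at hd
  exact ⟨x₁, x₂, x₃, x₄, by simp_all, by simp_all, by simp_all, by simp [hd, mul_assoc]⟩

/-- The quadratic factor of the difference of the values at the critical points `x` and `y` of a
monic quintic whose other two critical points are `z` and `w`. -/
def conic (x y z w : ℝ) : ℝ := (y - x) ^ 2 + 5 * (x + y - 2 * z) * (x + y - 2 * w)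

theorem eval_sub_eval_of_derivative_eq {P : ℝ[X]} {x y z w : ℝ}
    (hP : derivative P = C 5 * ((X - C x) * (X - C y) * (X - C z) * (X - C w))) :
    P.eval x - P.eval y = (y - x) ^ 3 / 24 * conic x y z w := by
  let Q : ℝ[X] := X ^ 5 - C (5 / 4 * (x + y + z + w)) * X ^ 4 +
    C (5 / 3 * (x * y + x * z + x * w + y * z + y * w + z * w)) * X ^ 3 -
    C (5 / 2 * (x * y * z + x * y * w + x * z * w + y * z * w)) * X ^ 2 + C (5 * x * y * z * w) * X
  have hQ : derivative (P - Q) = 0 := by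
    refine Polynomial.funext fun v => ?_
    simp [hP, Q]
    ring
  obtain ⟨m, hm⟩ := natDegree_eq_zero.1 (derivative_eq_zero.1 hQ)
  rw [← sub_add_cancel P Q, ← hm]
  simp only [map_mul, map_add, eval_add, eval_C, eval_sub, eval_pow, eval_X, eval_mul,
    add_sub_add_left_eq_sub, conic, Q]
  ring

theorem cmp_eval_eval_of_derivative_eq {P : ℝ[X]} {x y z w : ℝ} (hxy : x < y)
    (hP : derivative P = C 5 * ((X - C x) * (X - C y) * (X - C z) * (X - C w))) :
    cmp (P.eval x) (P.eval y) = cmp (conic x y z w) 0 := by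
  have hpos : 0 < (y - x) ^ 3 / 24 := by
    have := sub_pos.2 hxy
    positivity
  rw [← cmp_sub_zero, eval_sub_eval_of_derivative_eq hP,
    ← cmp_mul_pos_left hpos (conic x y z w), mul_zero]

theorem conic_pos {x y z w : ℝ} (hzw : 0 < (x + y - 2 * z) * (x + y - 2 * w)) :
    0 < conic x y z w := by
  rw [conic]
  nlinarith [sq_nonneg (y - x)]

theorem conic_neg {x y z w : ℝ} (hzx : z < x) (hxy : x < y) (hyw : y < w) :
    conic x y z w < 0 := by
  have hgaps : (y - x) * (y - x) < (x + y - 2 * z) * (2 * w - x - y) :=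
    mul_lt_mul'' (by linarith) (by linarith) (by linarith) (by linarith)
  rw [conic]
  nlinarith [sq_nonneg (y - x)]

namespace HasOrderedCriticalPoints

variable {P : ℝ[X]} {x₁ x₂ x₃ x₄ : ℝ}

theorem sort_criticalPoints (hP : HasOrderedCriticalPoints P x₁ x₂ x₃ x₄) :
    (criticalPoints P).sort (fun x y => x ≤ y) = [x₁, x₂, x₃, x₄] := by
  have hroots : (derivative P).roots = ([x₁, x₂, x₃, x₄] : List ℝ) := by
    rw [hP.derivative_eq, roots_C_mul _ (by norm_num),
      ← roots_multiset_prod_X_sub_C (([x₁, x₂, x₃, x₄] : List ℝ) : Multiset ℝ)]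
    simp [mul_assoc]
  have hsorted : [x₁, x₂, x₃, x₄].Pairwise (· < ·) := by
    have := hP.lt₁₂
    have := hP.lt₂₃
    have := hP.lt₃₄
    simp only [List.pairwise_cons, List.mem_cons, List.not_mem_nil, or_false, forall_eq_or_imp,
      forall_eq, IsEmpty.forall_iff, implies_true, List.Pairwise.nil, and_self, and_true]
    grind
  rw [criticalPoints, hroots]
  exact (List.toFinset_sort _ hsorted.nodup).2 (hsorted.imp le_of_lt)

theorem card_criticalPoints (hP : HasOrderedCriticalPoints P x₁ x₂ x₃ x₄) :
    (criticalPoints P).card = 4 := by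
  rw [← Finset.length_sort (fun x y => x ≤ y), hP.sort_criticalPoints]
  rfl

theorem passport_eq (hP : HasOrderedCriticalPoints P x₁ x₂ x₃ x₄) :
    passport P = ranks [P.eval x₁, P.eval x₂, P.eval x₃, P.eval x₄] :=
  passport_eq_ranks hP.sort_criticalPoints

theorem natDegree_eq (hP : HasOrderedCriticalPoints P x₁ x₂ x₃ x₄) : P.natDegree = 5 := by
  have hdeg : (derivative P).natDegree = 4 := by
    rw [hP.derivative_eq]
    compute_degree!
  rw [natDegree_derivative] at hdeg
  omega

theorem monic (hP : HasOrderedCriticalPoints P x₁ x₂ x₃ x₄) : P.Monic := by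
  have hcoeff := congrArg leadingCoeff hP.derivative_eq
  rw [leadingCoeff, natDegree_derivative, coeff_derivative, hP.natDegree_eq] at hcoeff
  simp only [leadingCoeff_mul, leadingCoeff_X_sub_C, leadingCoeff_C, mul_one] at hcoeff
  rw [Monic, leadingCoeff, hP.natDegree_eq]
  norm_num at hcoeff
  exact hcoeff

theorem isGreatest_passport (hP : HasOrderedCriticalPoints P x₁ x₂ x₃ x₄) :
    IsGreatest {n | n ∈ passport P} (criticalValues P).card :=
  MorseQuintic.isGreatest_passport (Finset.card_pos.1 (by rw [hP.card_criticalPoints]; norm_num))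

theorem isMorse_iff (hP : HasOrderedCriticalPoints P x₁ x₂ x₃ x₄) :
    IsMorse P ↔ IsGreatest {n | n ∈ passport P} 4 := by
  rw [MorseQuintic.isMorse_iff, hP.card_criticalPoints, hP.natDegree_eq]
  exact ⟨fun h => h.2.2 ▸ hP.isGreatest_passport,
    fun h => ⟨hP.monic, rfl, hP.isGreatest_passport.unique h⟩⟩

theorem isDegenerateSnake_iff (hP : HasOrderedCriticalPoints P x₁ x₂ x₃ x₄) :
    IsDegenerateSnake P ↔ IsGreatest {n | n ∈ passport P} 3 :=
  ⟨fun h => h.2.2.2 ▸ hP.isGreatest_passport, fun h =>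
    ⟨hP.monic, hP.natDegree_eq, hP.card_criticalPoints, hP.isGreatest_passport.unique h⟩⟩

theorem eval₂_lt_eval₁ (hP : HasOrderedCriticalPoints P x₁ x₂ x₃ x₄) :
    P.eval x₂ < P.eval x₁ := by
  obtain ⟨h₁₂, h₂₃, h₃₄, hd⟩ := hP
  refine (lt_iff_lt_of_cmp_eq_cmp ((cmp_eq_cmp_symm).1
    (cmp_eval_eval_of_derivative_eq h₁₂ hd))).2 (conic_pos ?_)
  exact mul_pos_of_neg_of_neg (by linarith) (by linarith)

theorem eval₂_lt_eval₃ (hP : HasOrderedCriticalPoints P x₁ x₂ x₃ x₄) :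
    P.eval x₂ < P.eval x₃ := by
  obtain ⟨h₁₂, h₂₃, h₃₄, hd⟩ := hP
  refine (lt_iff_lt_of_cmp_eq_cmp (cmp_eval_eval_of_derivative_eq h₂₃ ?_)).2
    (conic_neg h₁₂ h₂₃ h₃₄)
  rw [hd]
  ring

theorem eval₄_lt_eval₃ (hP : HasOrderedCriticalPoints P x₁ x₂ x₃ x₄) :
    P.eval x₄ < P.eval x₃ := by
  obtain ⟨h₁₂, h₂₃, h₃₄, hd⟩ := hP
  refine (lt_iff_lt_of_cmp_eq_cmp ((cmp_eq_cmp_symm).1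
    (cmp_eval_eval_of_derivative_eq h₃₄ (z := x₁) (w := x₂) ?_))).2 (conic_pos ?_)
  · rw [hd]
    ring
  · exact mul_pos (by linarith) (by linarith)

end HasOrderedCriticalPoints

/-- The polynomial `q` with parameters `u` has the roots `r`, `s`, `t` (with multiplicity),
expressed by Vieta's formulas. -/
def HasRoots (u : ℝ × ℝ) (r s t : ℝ) : Prop :=
  r + s + t = -3 ∧ u.1 = r * s + r * t + s * t ∧ u.2 = -(r * s * t)

section Family

variable {u : ℝ × ℝ} {r s t : ℝ}

theorem eval_p (x : ℝ) :
    (p u).eval x = x ^ 5 + 15 / 4 * x ^ 4 + 5 * u.1 / 3 * x ^ 3 + 5 * u.2 / 2 * x ^ 2 := by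
  simp [p]

theorem eval_q (x : ℝ) : (q u).eval x = x ^ 3 + 3 * x ^ 2 + u.1 * x + u.2 := by
  simp [q]

theorem derivative_p : derivative (p u) = C 5 * (X * q u) := by
  refine Polynomial.funext fun x => ?_
  simp [p, eval_q]
  ring

theorem natDegree_p : (p u).natDegree = 5 := by
  rw [p]
  compute_degree!

theorem discr_q : (q u).discr = dq u := by
  have hdegree : (q u).degree = 3 := by
    rw [q]
    compute_degree!
  rw [discr_of_degree_eq_three hdegree]
  simp [q, coeff_X, coeff_C, dq, coeff_X_pow]
  ring

theorem q_eq_iff_hasRoots : q u = (X - C r) * (X - C s) * (X - C t) ↔ HasRoots u r s t := by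
  constructor
  · intro hq
    have h0 := congrArg (eval 0) hq
    have h1 := congrArg (eval 1) hq
    have h2 := congrArg (eval (-1)) hq
    simp only [eval_q, eval_mul, eval_sub, eval_X, eval_C] at h0 h1 h2
    refine ⟨?_, ?_, ?_⟩ <;> linarith
  · rintro ⟨hsum, hb, hc⟩
    refine Polynomial.funext fun x => ?_
    simp only [eval_q, hb, hc, eval_mul, eval_sub, eval_X, eval_C]
    linear_combination x ^ 2 * hsum

theorem hasOrderedCriticalPoints_p_iff :
    HasOrderedCriticalPoints (p u) r s t 0 ↔ r < s ∧ s < t ∧ t < 0 ∧ HasRoots u r s t := by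
  have derivative_eq_iff :
      derivative (p u) = C 5 * ((X - C r) * (X - C s) * (X - C t) * (X - C 0)) ↔
        HasRoots u r s t := by
    rw [derivative_p, C_0, sub_zero, mul_comm _ X,
      mul_right_inj' (C_ne_zero.2 (by norm_num : (5 : ℝ) ≠ 0)), mul_right_inj' X_ne_zero,
      q_eq_iff_hasRoots]
  rw [← derivative_eq_iff]
  exact ⟨fun h => ⟨h.1, h.2, h.3, h.4⟩, fun h => ⟨h.1, h.2.1, h.2.2.1, h.2.2.2⟩⟩

theorem mem_region_iff : u ∈ region ↔ ∃ r s t, HasOrderedCriticalPoints (p u) r s t 0 := by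
  simp only [region, Set.mem_ofPred_eq, q_eq_iff_hasRoots, hasOrderedCriticalPoints_p_iff]

end Family

section Normalization

theorem exists_hasOrderedCriticalPoints_comp {P : ℝ[X]} {x₁ x₂ x₃ x₄ : ℝ}
    (hP : HasOrderedCriticalPoints P x₁ x₂ x₃ x₄) : ∃ k > 0, ∃ l r s t : ℝ,
      r < s ∧ s < t ∧ t < 0 ∧ r + s + t = -3 ∧ derivative (P.comp (C k * X + C l)) =
        C (k ^ 5) * (C 5 * ((X - C r) * (X - C s) * (X - C t) * (X - C 0))) := by
  obtain ⟨h₁₂, h₂₃, h₃₄, hd⟩ := hP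
  have hk : 0 < (3 * x₄ - x₁ - x₂ - x₃) / 3 := by linarith
  generalize hkdef : (3 * x₄ - x₁ - x₂ - x₃) / 3 = k at hk
  refine ⟨k, hk, x₄, (x₁ - x₄) / k, (x₂ - x₄) / k, (x₃ - x₄) / k, by gcongr, by gcongr,
    div_neg_of_neg_of_pos (by linarith) hk, ?_, ?_⟩
  · rw [← add_div, ← add_div, div_eq_iff hk.ne']
    linarith
  · refine Polynomial.funext fun x => ?_
    simp [derivative_comp, hd]
    field_simp
    ring

theorem exists_comp_eq_p {P : ℝ[X]} {x₁ x₂ x₃ x₄ : ℝ}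
    (hP : HasOrderedCriticalPoints P x₁ x₂ x₃ x₄) :
    ∃ u ∈ region, passport (p u) = passport P ∧ ∃ k l m : ℝ, 0 < k ∧
      P.comp (C k * X + C l) = C (k ^ 5) * p u + C m := by
  obtain ⟨k, hk, l, r, s, t, hrs, hst, ht, hsum, hd⟩ := exists_hasOrderedCriticalPoints_comp hP
  let u : ℝ × ℝ := (r * s + r * t + s * t, -(r * s * t))
  have hu : HasOrderedCriticalPoints (p u) r s t 0 :=
    hasOrderedCriticalPoints_p_iff.2 ⟨hrs, hst, ht, hsum, rfl, rfl⟩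
  obtain ⟨m, hm⟩ : ∃ m, C m = P.comp (C k * X + C l) - C (k ^ 5) * p u :=
    natDegree_eq_zero.1 <| derivative_eq_zero.1 <| by
      rw [derivative_sub, hd, derivative_C_mul, hu.derivative_eq, sub_self]
  have hcomp : P.comp (C k * X + C l) = C (k ^ 5) * p u + C m := by rw [hm, add_sub_cancel]
  refine ⟨u, mem_region_iff.2 ⟨r, s, t, hu⟩, ?_, k, l, m, hk, hcomp⟩
  rw [← passport_C_mul_add_C (pow_pos hk 5) m, ← hcomp, passport_comp_C_mul_X_add_C hk]

theorem exists_hasOrderedCriticalPoints_of_isMorse {P : ℝ[X]} (h5 : P.natDegree = 5)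
    (hP : IsMorse P) : ∃ x₁ x₂ x₃ x₄, HasOrderedCriticalPoints P x₁ x₂ x₃ x₄ := by
  obtain ⟨hmonic, hcard, -⟩ := isMorse_iff.1 hP
  exact exists_hasOrderedCriticalPoints hmonic h5 (by omega)

theorem exists_normalization {P : ℝ[X]} (h5 : P.natDegree = 5) (hP : IsMorse P) :
    ∃ u ∈ region, ∃ k l m : ℝ, 0 < k ∧ P.comp (C k * X + C l) = C (k ^ 5) * p u + C m ∧
      IsMorse (p u) ∧ passport (p u) = passport P := by
  obtain ⟨x₁, x₂, x₃, x₄, hx⟩ := exists_hasOrderedCriticalPoints_of_isMorse h5 hP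
  obtain ⟨u, hu, hpass, k, l, m, hk, hcomp⟩ := exists_comp_eq_p hx
  obtain ⟨r, s, t, hrst⟩ := mem_region_iff.1 hu
  refine ⟨u, hu, k, l, m, hk, hcomp, ?_, hpass⟩
  rwa [hrst.isMorse_iff, hpass, ← hx.isMorse_iff]

end Normalization

section SpecialCurves

variable {u : ℝ × ℝ} {r s t : ℝ}

theorem HasRoots.isRoot_q_iff (hu : HasRoots u r s t) (x : ℝ) :
    (q u).IsRoot x ↔ x = r ∨ x = s ∨ x = t := by
  rw [q_eq_iff_hasRoots.2 hu]
  simp [sub_eq_zero, or_assoc]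

theorem HasRoots.g_eq (hu : HasRoots u r s t) :
    -8 * g u = conic r s t 0 * conic s t r 0 * conic r t s 0 := by
  obtain ⟨hsum, hb, hc⟩ := hu
  obtain rfl : t = -3 - r - s := by linarith
  simp only [g, hb, hc, conic]
  ring

theorem HasRoots.h_eq (hu : HasRoots u r s t) :
    8 * h u = conic r 0 s t * conic s 0 r t * conic t 0 r s := by
  obtain ⟨hsum, hb, hc⟩ := hu
  obtain rfl : t = -3 - r - s := by linarith
  simp only [h, hb, hc, conic]
  ring

theorem HasRoots.dq_eq (hu : HasRoots u r s t) :
    dq u = ((s - r) * (t - s) * (t - r)) ^ 2 := by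
  obtain ⟨hsum, hb, hc⟩ := hu
  obtain rfl : t = -3 - r - s := by linarith
  simp only [dq, hb, hc]
  ring

end SpecialCurves

section SpecialCurves

variable {u : ℝ × ℝ} {r s t : ℝ}

theorem HasOrderedCriticalPoints.hasRoots (hu : HasOrderedCriticalPoints (p u) r s t 0) :
    HasRoots u r s t :=
  (hasOrderedCriticalPoints_p_iff.1 hu).2.2.2

theorem g_eq_zero_iff_eval (hu : HasOrderedCriticalPoints (p u) r s t 0) :
    g u = 0 ↔ (p u).eval r = (p u).eval t := by
  obtain ⟨hrs, hst, -, hd⟩ := id hu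
  have hRS : (p u).eval r = (p u).eval s ↔ conic r s t 0 = 0 :=
    eq_iff_eq_of_cmp_eq_cmp (cmp_eval_eval_of_derivative_eq hrs hd)
  have hST : (p u).eval s = (p u).eval t ↔ conic s t r 0 = 0 :=
    eq_iff_eq_of_cmp_eq_cmp (cmp_eval_eval_of_derivative_eq hst (by rw [hd]; ring))
  have hRT : (p u).eval r = (p u).eval t ↔ conic r t s 0 = 0 :=
    eq_iff_eq_of_cmp_eq_cmp (cmp_eval_eval_of_derivative_eq (hrs.trans hst) (by rw [hd]; ring))
  have hfactor : g u = 0 ↔ -8 * g u = 0 := by simp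
  rw [hfactor, hu.hasRoots.g_eq, mul_eq_zero, mul_eq_zero, ← hRS, ← hST, ← hRT]
  simp only [hu.eval₂_lt_eval₁.ne', hu.eval₂_lt_eval₃.ne, false_or]

theorem h_eq_zero_iff_eval (hu : HasOrderedCriticalPoints (p u) r s t 0) :
    h u = 0 ↔ (p u).eval r = (p u).eval 0 ∨ (p u).eval s = (p u).eval 0 := by
  obtain ⟨hrs, hst, ht, hd⟩ := id hu
  have hR : (p u).eval r = (p u).eval 0 ↔ conic r 0 s t = 0 :=
    eq_iff_eq_of_cmp_eq_cmp (cmp_eval_eval_of_derivative_eq (by linarith) (by rw [hd]; ring))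
  have hS : (p u).eval s = (p u).eval 0 ↔ conic s 0 r t = 0 :=
    eq_iff_eq_of_cmp_eq_cmp (cmp_eval_eval_of_derivative_eq (by linarith) (by rw [hd]; ring))
  have hT : (p u).eval t = (p u).eval 0 ↔ conic t 0 r s = 0 :=
    eq_iff_eq_of_cmp_eq_cmp (cmp_eval_eval_of_derivative_eq ht (by rw [hd]; ring))
  have hfactor : h u = 0 ↔ 8 * h u = 0 := by simp
  rw [hfactor, hu.hasRoots.h_eq, mul_eq_zero, mul_eq_zero, ← hR, ← hS, ← hT]
  simp only [hu.eval₄_lt_eval₃.ne', or_false]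

theorem eval_p_zero : (p u).eval 0 = 0 := by
  simp [eval_p]

theorem g_eq_zero_iff (hu : u ∈ region) : g u = 0 ↔
    ∃ x y : ℝ, x ≠ y ∧ (q u).IsRoot x ∧ (q u).IsRoot y ∧ (p u).eval x = (p u).eval y := by
  obtain ⟨r, s, t, hrst⟩ := mem_region_iff.1 hu
  have hRS := hrst.eval₂_lt_eval₁
  have hST := hrst.eval₂_lt_eval₃
  simp only [hrst.hasRoots.isRoot_q_iff, g_eq_zero_iff_eval hrst]
  constructor
  · exact fun h => ⟨r, t, (hrst.lt₁₂.trans hrst.lt₂₃).ne, by simp, by simp, h⟩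
  · rintro ⟨x, y, hxy, rfl | rfl | rfl, rfl | rfl | rfl, h⟩ <;>
      first | exact absurd rfl hxy | order

theorem h_eq_zero_iff (hu : u ∈ region) :
    h u = 0 ↔ ∃ x : ℝ, (q u).IsRoot x ∧ (p u).eval x = 0 := by
  obtain ⟨r, s, t, hrst⟩ := mem_region_iff.1 hu
  have hT := hrst.eval₄_lt_eval₃
  simp only [hrst.hasRoots.isRoot_q_iff, h_eq_zero_iff_eval hrst]
  rw [eval_p_zero] at hT ⊢
  simp [or_and_right, exists_or, hT.ne']

theorem isMorse_p_iff_of_mem_region (hu : u ∈ region) : IsMorse (p u) ↔ g u ≠ 0 ∧ h u ≠ 0 := by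
  obtain ⟨r, s, t, hrst⟩ := mem_region_iff.1 hu
  rw [hrst.isMorse_iff, Ne, Ne, g_eq_zero_iff_eval hrst, h_eq_zero_iff_eval hrst,
    hrst.passport_eq]
  have hRS := hrst.eval₂_lt_eval₁
  have hST := hrst.eval₂_lt_eval₃
  have hT := hrst.eval₄_lt_eval₃
  rcases ranks_cases_of_snake hRS hST hT with
    h | h | h | h | h | h | h | h | h | h | h <;>
    simp [h, IsGreatest, upperBounds] <;> grind

end SpecialCurves

section DiscriminantCurve

variable {u : ℝ × ℝ} {r s t x : ℝ}

theorem exists_isRoot_q (hb : 0 ≤ u.1) (hc : 0 ≤ u.2) : ∃ x, (q u).IsRoot x := by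
  have hneg : (q u).eval (-(4 + u.1 + u.2)) ≤ 0 := by
    have : 0 ≤ (4 + u.1 + u.2) * (1 + u.1 + u.2) * (4 + u.1 + u.2) := by positivity
    rw [eval_q]
    nlinarith [mul_nonneg hb hb, mul_nonneg hb hc, mul_nonneg hc hc]
  have hpos : 0 ≤ (q u).eval 0 := by simpa [eval_q] using hc
  obtain ⟨x, -, hx⟩ := intermediate_value_Icc (by linarith) (q u).continuousOn ⟨hneg, hpos⟩
  exact ⟨x, hx⟩

theorem nonpos_of_isRoot_q (hb : 0 ≤ u.1) (hc : 0 ≤ u.2) (hx : (q u).IsRoot x) : x ≤ 0 := by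
  by_contra! hpos
  have : 0 < x ^ 3 + 3 * x ^ 2 + u.1 * x + u.2 := by positivity
  rw [← eval_q, hx] at this
  exact this.false

theorem exists_hasRoots_of_isRoot (hd : 0 ≤ dq u) (hx : (q u).IsRoot x) :
    ∃ y z, HasRoots u x y z := by
  obtain ⟨e, he⟩ : ∃ e, e = u.1 + x * (3 + x) := ⟨_, rfl⟩
  have hb : u.1 = e - x * (3 + x) := by linarith
  have hc : u.2 = -(x * e) := by
    rw [IsRoot, eval_q] at hx
    linear_combination hx + x * he
  have hdisc : dq u = ((3 + x) ^ 2 - 4 * e) * (x ^ 2 + (3 + x) * x + e) ^ 2 := by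
    rw [dq, hb, hc]
    ring
  have hD : 0 ≤ (3 + x) ^ 2 - 4 * e := by
    by_contra! hneg
    have hpos : 0 < x ^ 2 + (3 + x) * x + e := by nlinarith [sq_nonneg (2 * x + (3 + x))]
    exact (mul_neg_of_neg_of_pos hneg (pow_pos hpos 2)).not_ge (hdisc ▸ hd)
  have hsq := Real.sq_sqrt hD
  refine ⟨(-(3 + x) - √((3 + x) ^ 2 - 4 * e)) / 2, (-(3 + x) + √((3 + x) ^ 2 - 4 * e)) / 2,
    by ring, ?_, ?_⟩
  · linear_combination hb + hsq / 4
  · linear_combination hc - x * hsq / 4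

theorem HasRoots.swap_left (hu : HasRoots u r s t) : HasRoots u s r t := by
  obtain ⟨hsum, hb, hc⟩ := hu
  exact ⟨by linarith, by linarith, by linarith⟩

theorem HasRoots.swap_right (hu : HasRoots u r s t) : HasRoots u r t s := by
  obtain ⟨hsum, hb, hc⟩ := hu
  exact ⟨by linarith, by linarith, by linarith⟩

theorem exists_sorted_hasRoots (hb : 0 ≤ u.1) (hc : 0 ≤ u.2) (hd : 0 ≤ dq u) :
    ∃ r s t : ℝ, r ≤ s ∧ s ≤ t ∧ t ≤ 0 ∧ HasRoots u r s t := by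
  suffices ∃ r s t : ℝ, r ≤ s ∧ s ≤ t ∧ HasRoots u r s t by
    obtain ⟨r, s, t, hrs, hst, hu⟩ := this
    exact ⟨r, s, t, hrs, hst, nonpos_of_isRoot_q hb hc ((hu.isRoot_q_iff t).2 (by simp)), hu⟩
  obtain ⟨x, hx⟩ := exists_isRoot_q hb hc
  obtain ⟨y, z, hu⟩ := exists_hasRoots_of_isRoot hd hx
  wlog hyz : y ≤ z generalizing y z
  · exact this z y hu.swap_right (le_of_not_ge hyz)
  rcases le_total x y with hxy | hyx
  · exact ⟨x, y, z, hxy, hyz, hu⟩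
  rcases le_total x z with hxz | hzx
  · exact ⟨y, x, z, hyx, hxz, hu.swap_left⟩
  · exact ⟨y, z, x, hyz, hzx, hu.swap_left.swap_right⟩

theorem region_eq : region = {u | 0 < u.1 ∧ 0 < u.2 ∧ 0 < dq u} := by
  ext u
  simp only [mem_region_iff, hasOrderedCriticalPoints_p_iff, Set.mem_ofPred_eq]
  constructor
  · rintro ⟨r, s, t, hrs, hst, ht, hu⟩
    have hs := hst.trans ht
    have hr := hrs.trans hs
    refine ⟨?_, ?_, ?_⟩
    · rw [hu.2.1]
      linarith [mul_pos_of_neg_of_neg hr hs, mul_pos_of_neg_of_neg hr ht,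
        mul_pos_of_neg_of_neg hs ht]
    · rw [hu.2.2]
      linarith [mul_neg_of_pos_of_neg (mul_pos_of_neg_of_neg hr hs) ht]
    · rw [hu.dq_eq]
      exact pow_pos (mul_pos (mul_pos (sub_pos.2 hrs) (sub_pos.2 hst))
        (sub_pos.2 (hrs.trans hst))) 2
  · rintro ⟨hb, hc, hd⟩
    obtain ⟨r, s, t, hrs, hst, ht, hu⟩ := exists_sorted_hasRoots hb.le hc.le hd.le
    refine ⟨r, s, t, hrs.lt_of_ne ?_, hst.lt_of_ne ?_, ht.lt_of_ne ?_, hu⟩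
    · rintro rfl
      simp [hu.dq_eq] at hd
    · rintro rfl
      simp [hu.dq_eq] at hd
    · rintro rfl
      simp [hu.2.2] at hc

theorem isOpen_region : IsOpen region := by
  have hdq : Continuous dq := by
    unfold dq
    fun_prop
  rw [region_eq]
  exact (isOpen_lt continuous_const continuous_fst).inter
    ((isOpen_lt continuous_const continuous_snd).inter (isOpen_lt continuous_const hdq))

theorem mem_region_of_isMorse_p (hb : 0 < u.1) (hc : 0 < u.2) (hM : IsMorse (p u)) :
    u ∈ region := by
  obtain ⟨x₁, x₂, x₃, x₄, hx⟩ := exists_hasOrderedCriticalPoints_of_isMorse natDegree_p hM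
  have hprod (x : ℝ) :
      x * (x ^ 3 + 3 * x ^ 2 + u.1 * x + u.2) = (x - x₁) * (x - x₂) * (x - x₃) * (x - x₄) := by
    have := congrArg (eval x) (derivative_p.symm.trans hx.derivative_eq)
    simpa [eval_q] using this
  obtain rfl : x₄ = 0 := by
    rcases lt_trichotomy x₄ 0 with hneg | hzero | hpos
    · have h₃ := hx.lt₃₄.trans hneg
      have h₂ := hx.lt₂₃.trans h₃
      have h₁ := hx.lt₁₂.trans h₂
      have := hprod 0
      simp [h₁.ne, h₂.ne, h₃.ne, hneg.ne] at this
    · exact hzero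
    · have := hprod x₄
      have : 0 < x₄ * (x₄ ^ 3 + 3 * x₄ ^ 2 + u.1 * x₄ + u.2) := by positivity
      simp_all
  exact mem_region_iff.2 ⟨x₁, x₂, x₃, hx⟩

theorem isMorse_p_iff_of_pos (hb : 0 < u.1) (hc : 0 < u.2) :
    IsMorse (p u) ↔ u ∈ region ∧ g u ≠ 0 ∧ h u ≠ 0 := by
  constructor
  · intro hM
    have hu := mem_region_of_isMorse_p hb hc hM
    exact ⟨hu, (isMorse_p_iff_of_mem_region hu).1 hM⟩
  · rintro ⟨hu, hgh⟩
    exact (isMorse_p_iff_of_mem_region hu).2 hgh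

end DiscriminantCurve

section Chart

/-- The open unit square, the domain of the chart of `region`. -/
def openSquare : Set (ℝ × ℝ) := Set.Ioo 0 1 ×ˢ Set.Ioo 0 1

/-- The closed unit square, the domain of the chart of the closed triangle `OAB`. -/
def closedSquare : Set (ℝ × ℝ) := Set.Icc 0 1 ×ˢ Set.Icc 0 1

theorem openSquare_subset_closedSquare : openSquare ⊆ closedSquare :=
  Set.prod_mono Set.Ioo_subset_Icc_self Set.Ioo_subset_Icc_self

theorem isCompact_closedSquare : IsCompact closedSquare :=
  isCompact_Icc.prod isCompact_Icc

/-- The factor by which the gaps of the chart are scaled, chosen so that the sum of the roots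
is `-3`. -/
noncomputable def chartScale (x : ℝ × ℝ) : ℝ := 3 / (1 + x.2 + 2 * x.1 * (1 - x.2))

/-- The smallest root of the polynomial `q` with parameters `chart x`. -/
noncomputable def chartR (x : ℝ × ℝ) : ℝ := -chartScale x

/-- The middle root of the polynomial `q` with parameters `chart x`. -/
noncomputable def chartS (x : ℝ × ℝ) : ℝ := -(chartScale x * (x.2 + x.1 * (1 - x.2)))

/-- The largest root of the polynomial `q` with parameters `chart x`. -/
noncomputable def chartT (x : ℝ × ℝ) : ℝ := -(chartScale x * (x.1 * (1 - x.2)))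

/-- The chart of the closed triangle `OAB`: the point `(l, w)` of the unit square is sent to the
polynomial `q` whose roots `r ≤ s ≤ t ≤ 0` have the gaps `s - r`, `t - s`, `-t` proportional to
`(1 - l) * (1 - w)`, `w`, `l * (1 - w)`. The side `w = 1` is collapsed to the vertex `B`. -/
noncomputable def chart (x : ℝ × ℝ) : ℝ × ℝ :=
  (chartR x * chartS x + chartR x * chartT x + chartS x * chartT x,
    -(chartR x * chartS x * chartT x))

variable {x y u : ℝ × ℝ} {r s t r' s' t' : ℝ}

theorem chartScale_den_pos (hx : x ∈ closedSquare) : 0 < 1 + x.2 + 2 * x.1 * (1 - x.2) := by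
  obtain ⟨⟨hl₀, -⟩, hw₀, hw₁⟩ := hx
  nlinarith [mul_nonneg hl₀ (sub_nonneg.2 hw₁)]

theorem chartScale_pos (hx : x ∈ closedSquare) : 0 < chartScale x :=
  div_pos three_pos (chartScale_den_pos hx)

theorem continuousOn_chart : ContinuousOn chart closedSquare := by
  have hscale : ContinuousOn chartScale closedSquare :=
    ContinuousOn.div (by fun_prop) (by fun_prop) fun x hx => (chartScale_den_pos hx).ne'
  unfold chart chartR chartS chartT
  fun_prop

theorem hasRoots_chart (hx : x ∈ closedSquare) :
    HasRoots (chart x) (chartR x) (chartS x) (chartT x) := by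
  refine ⟨?_, rfl, rfl⟩
  have := chartScale_den_pos hx
  simp only [chartR, chartS, chartT, chartScale]
  field_simp
  ring

theorem chartS_sub_chartR : chartS x - chartR x = chartScale x * ((1 - x.1) * (1 - x.2)) := by
  rw [chartS, chartR]
  ring

theorem chartT_sub_chartS : chartT x - chartS x = chartScale x * x.2 := by
  rw [chartT, chartS]
  ring

theorem neg_chartT : -chartT x = chartScale x * (x.1 * (1 - x.2)) :=
  neg_neg _

theorem chartR_le_chartS (hx : x ∈ closedSquare) : chartR x ≤ chartS x := by
  rw [← sub_nonneg, chartS_sub_chartR]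
  exact mul_nonneg (chartScale_pos hx).le
    (mul_nonneg (sub_nonneg.2 hx.1.2) (sub_nonneg.2 hx.2.2))

theorem chartS_le_chartT (hx : x ∈ closedSquare) : chartS x ≤ chartT x := by
  rw [← sub_nonneg, chartT_sub_chartS]
  exact mul_nonneg (chartScale_pos hx).le hx.2.1

theorem hasOrderedCriticalPoints_chart_iff (hx : x ∈ closedSquare) :
    HasOrderedCriticalPoints (p (chart x)) (chartR x) (chartS x) (chartT x) 0 ↔
      x ∈ openSquare := by
  have hk := chartScale_pos hx
  rw [hasOrderedCriticalPoints_p_iff, and_iff_left (hasRoots_chart hx), ← sub_pos,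
    ← sub_pos (a := chartT x), ← neg_pos (a := chartT x), chartS_sub_chartR, chartT_sub_chartS,
    neg_chartT, mul_pos_iff_of_pos_left hk, mul_pos_iff_of_pos_left hk,
    mul_pos_iff_of_pos_left hk]
  obtain ⟨⟨hl₀, -⟩, -, hw₁⟩ := hx
  constructor
  · rintro ⟨hR, hS, hT⟩
    exact ⟨⟨pos_of_mul_pos_left hT (sub_nonneg.2 hw₁), sub_pos.1
      (pos_of_mul_pos_left hR (sub_nonneg.2 hw₁))⟩, hS,
      sub_pos.1 (pos_of_mul_pos_right hT hl₀)⟩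
  · rintro ⟨⟨hl₀, hl₁⟩, hw₀, hw₁⟩
    exact ⟨mul_pos (sub_pos.2 hl₁) (sub_pos.2 hw₁), hw₀, mul_pos hl₀ (sub_pos.2 hw₁)⟩

theorem HasRoots.unique (hu : HasRoots u r s t) (hu' : HasRoots u r' s' t') (hrs : r ≤ s)
    (hst : s ≤ t) (hrs' : r' ≤ s') (hst' : s' ≤ t') : r = r' ∧ s = s' ∧ t = t' := by
  have hroot (x : ℝ) : x = r ∨ x = s ∨ x = t ↔ x = r' ∨ x = s' ∨ x = t' := by
    rw [← hu.isRoot_q_iff, ← hu'.isRoot_q_iff]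
  have hr : r = r' := by
    have := (hroot r).1 (by simp)
    have := (hroot r').2 (by simp)
    grind
  have ht : t = t' := by
    have := (hroot t).1 (by simp)
    have := (hroot t').2 (by simp)
    grind
  exact ⟨hr, by linarith [hu.1, hu'.1], ht⟩

theorem eq_of_chart_eq (hx : x ∈ closedSquare) (hy : y ∈ closedSquare) (hw : x.2 < 1)
    (hxy : chart x = chart y) : x = y := by
  obtain ⟨hr, hs, ht⟩ := (hasRoots_chart hx).unique (hxy ▸ hasRoots_chart hy)
    (chartR_le_chartS hx) (chartS_le_chartT hx) (chartR_le_chartS hy) (chartS_le_chartT hy)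
  have hk : chartScale x = chartScale y := neg_injective hr
  have hk₀ := (chartScale_pos hy).ne'
  have hw' : x.2 = y.2 := mul_left_cancel₀ hk₀ <| by
    rw [← chartT_sub_chartS, ← hk, ← chartT_sub_chartS, hs, ht]
  rw [chartT, chartT, hk, neg_inj, mul_right_inj' hk₀, ← hw',
    mul_left_inj' (sub_pos.2 hw).ne'] at ht
  exact Prod.ext ht hw'

theorem exists_gaps_eq {a b c : ℝ} (ha : 0 ≤ a) (hb : 0 ≤ b) (hc : 0 ≤ c) (hsum : a + b + c = 1) :
    ∃ x ∈ closedSquare, (1 - x.1) * (1 - x.2) = a ∧ x.2 = b ∧ x.1 * (1 - x.2) = c := by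
  rcases (add_nonneg ha hc).eq_or_lt' with hac | hac
  · exact ⟨(0, b), ⟨by simp, hb, by simp only; linarith⟩, by simp only; linarith, rfl,
      by simp only; linarith⟩
  · obtain rfl : b = 1 - (a + c) := by linarith
    refine ⟨(c / (a + c), 1 - (a + c)), ⟨⟨by positivity, ?_⟩, hb, by simp only; linarith⟩,
      ?_, rfl, ?_⟩
    · exact div_le_one_of_le₀ (by linarith) hac.le
    · field_simp
      ring
    · field_simp
      ring

theorem exists_chart_eq (hrs : r ≤ s) (hst : s ≤ t) (ht : t ≤ 0) (hu : HasRoots u r s t) :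
    ∃ x ∈ closedSquare, chart x = u ∧ chartR x = r ∧ chartS x = s ∧ chartT x = t := by
  obtain ⟨hsum, hb, hc⟩ := hu
  have hr : 0 < -r := by linarith
  obtain ⟨x, hx, hgap₁, hgap₂, hgap₃⟩ := exists_gaps_eq (a := (s - r) / -r) (b := (t - s) / -r)
    (c := -t / -r) (div_nonneg (by linarith) hr.le) (div_nonneg (by linarith) hr.le)
    (div_nonneg (by linarith) hr.le)
    (by rw [← add_div, ← add_div, div_eq_one_iff_eq hr.ne']; ring)
  have hscale : chartScale x = -r := by
    have hden : 1 + x.2 + 2 * x.1 * (1 - x.2) = 3 / -r := by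
      rw [mul_assoc, hgap₃, hgap₂, eq_div_iff hr.ne', add_mul, add_mul, mul_assoc 2,
        div_mul_cancel₀ _ hr.ne', div_mul_cancel₀ _ hr.ne']
      linarith
    rw [chartScale, hden]
    field_simp
  have hR : chartR x = r := by rw [chartR, hscale, neg_neg]
  have hS : chartS x = s := by
    rw [← sub_add_cancel (chartS x) (chartR x), chartS_sub_chartR, hscale, hgap₁, hR,
      mul_div_cancel₀ _ hr.ne']
    ring
  have hT : chartT x = t := by rw [chartT, hscale, hgap₃, mul_div_cancel₀ _ hr.ne', neg_neg]
  exact ⟨x, hx, Prod.ext (by rw [hb, chart, hR, hS, hT]) (by rw [hc, chart, hR, hS, hT]),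
    hR, hS, hT⟩

theorem image_chart_openSquare : chart '' openSquare = region := by
  ext u
  rw [mem_region_iff]
  constructor
  · rintro ⟨x, hx, rfl⟩
    exact ⟨_, _, _, (hasOrderedCriticalPoints_chart_iff (openSquare_subset_closedSquare hx)).2 hx⟩
  · rintro ⟨r, s, t, hrst⟩
    obtain ⟨x, hx, rfl, rfl, rfl, rfl⟩ :=
      exists_chart_eq hrst.lt₁₂.le hrst.lt₂₃.le hrst.lt₃₄.le hrst.hasRoots
    exact ⟨x, (hasOrderedCriticalPoints_chart_iff hx).1 hrst, rfl⟩

end Chart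

section Threshold

variable {m n m' n' w : ℝ}

/-- The restriction to a vertical line of the chart of the quadratic forms `conic` that decide
the order of the critical values. -/
def verticalForm (m n w : ℝ) : ℝ := -2 * w ^ 2 + m * (w * (1 - w)) + n * (1 - w) ^ 2

/-- The zero of `verticalForm m n` in `[0, 1)`. -/
noncomputable def threshold (m n : ℝ) : ℝ :=
  (m + √(m ^ 2 + 8 * n)) / (4 + (m + √(m ^ 2 + 8 * n)))

theorem threshold_num_nonneg (hn : 0 ≤ n) : 0 ≤ m + √(m ^ 2 + 8 * n) := by
  have habs : |m| ≤ √(m ^ 2 + 8 * n) := Real.abs_le_sqrt (by linarith)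
  linarith [neg_abs_le m]

theorem threshold_nonneg (hn : 0 ≤ n) : 0 ≤ threshold m n :=
  div_nonneg (threshold_num_nonneg hn) (by linarith [threshold_num_nonneg (m := m) hn])

theorem threshold_lt_one (hn : 0 ≤ n) : threshold m n < 1 := by
  have := threshold_num_nonneg (m := m) hn
  rw [threshold, div_lt_one (by linarith)]
  linarith

theorem cmp_verticalForm (hn : 0 ≤ n) (hmn : 0 < n ∨ m < 0) (hw : w ∈ Set.Icc 0 1) :
    cmp (verticalForm m n w) 0 = cmp (threshold m n) w := by
  have hnum := threshold_num_nonneg (m := m) hn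
  have hsq := Real.sq_sqrt (show 0 ≤ m ^ 2 + 8 * n by positivity)
  have hlt : m < √(m ^ 2 + 8 * n) := by
    rcases hmn with hn | hm
    · exact Real.lt_sqrt_of_sq_lt (by linarith)
    · exact hm.trans_le (Real.sqrt_nonneg _)
  obtain ⟨hw₀, hw₁⟩ := hw
  rw [threshold]
  generalize √(m ^ 2 + 8 * n) = d at *
  have hfactor : verticalForm m n w =
      (4 + (m + d)) / 2 * (w + (d - m) / 4 * (1 - w)) * ((m + d) / (4 + (m + d)) - w) := by
    have : (4 + (m + d)) ≠ 0 := by linarith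
    rw [verticalForm]
    field_simp
    linear_combination (-(1 - w) ^ 2) * hsq
  have hpos : 0 < w + (d - m) / 4 * (1 - w) := by
    rcases hw₀.eq_or_lt with rfl | hw₀
    · linarith
    · exact add_pos_of_pos_of_nonneg hw₀ (mul_nonneg (by linarith) (by linarith))
  have hcmp := cmp_mul_pos_left (mul_pos (by linarith : 0 < (4 + (m + d)) / 2) hpos)
    ((m + d) / (4 + (m + d)) - w) 0
  rwa [mul_zero, ← hfactor, cmp_sub_zero] at hcmp

theorem verticalForm_threshold (hn : 0 ≤ n) (hmn : 0 < n ∨ m < 0) :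
    verticalForm m n (threshold m n) = 0 :=
  (eq_iff_eq_of_cmp_eq_cmp (cmp_verticalForm hn hmn
    ⟨threshold_nonneg hn, (threshold_lt_one hn).le⟩)).2 rfl

theorem threshold_lt_threshold_iff (hn : 0 ≤ n) (hn' : 0 ≤ n') (hmn' : 0 < n' ∨ m' < 0) :
    threshold m n < threshold m' n' ↔ 0 < verticalForm m' n' (threshold m n) :=
  (lt_iff_lt_of_cmp_eq_cmp (cmp_eq_cmp_symm.1 (cmp_verticalForm hn' hmn'
    ⟨threshold_nonneg hn, (threshold_lt_one hn).le⟩))).symm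

theorem threshold_lt_threshold (hn : 0 ≤ n) (hmn : 0 < n ∨ m < 0) (hm : m ≤ m') (hnn' : n < n') :
    threshold m n < threshold m' n' := by
  have hw₀ := threshold_nonneg (m := m) hn
  have hw₁ := threshold_lt_one (m := m) hn
  rw [threshold_lt_threshold_iff hn (hn.trans hnn'.le) (Or.inl (hn.trans_lt hnn')),
    ← verticalForm_threshold hn hmn, verticalForm, verticalForm]
  have : 0 < 1 - threshold m n := sub_pos.2 hw₁
  refine add_lt_add_of_le_of_lt ?_ ?_ <;> gcongr

theorem threshold_pos (hn : 0 < n) : 0 < threshold m n :=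
  (lt_iff_lt_of_cmp_eq_cmp (cmp_eq_cmp_symm.1 (cmp_verticalForm hn.le (Or.inl hn) (by simp)))).1
    (by simpa [verticalForm] using hn)

theorem threshold_of_sq_eq {d : ℝ} (hd : 0 ≤ d) (hsq : m ^ 2 + 8 * n = d ^ 2) :
    threshold m n = (m + d) / (4 + (m + d)) := by
  rw [threshold, hsq, Real.sqrt_sq hd]

theorem continuousOn_threshold {f f' : ℝ → ℝ} {s : Set ℝ} (hf : ContinuousOn f s)
    (hf' : ContinuousOn f' s) (hn : ∀ l ∈ s, 0 ≤ f' l) :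
    ContinuousOn (fun l => threshold (f l) (f' l)) s := by
  unfold threshold
  refine ContinuousOn.div (by fun_prop) (by fun_prop) fun l hl => ?_
  have := threshold_num_nonneg (m := f l) (hn l hl)
  linarith

end Threshold

section Curves

variable {l w : ℝ}

/-- The curve on which the critical values at `r` and `t` are equal, as a graph in the chart. -/
noncomputable def curveRT (l : ℝ) : ℝ := threshold (1 - 6 * l) ((1 - l) * (3 + 2 * l))

/-- The curve on which the critical value at `s` vanishes, as a graph in the chart. -/
noncomputable def curveS (l : ℝ) : ℝ := curveRT (1 - l)

/-- The curve on which the critical value at `r` vanishes, as a graph in the chart. -/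
noncomputable def curveR (l : ℝ) : ℝ := threshold 1 (3 - 10 * l * (1 - l))

theorem coeffRT_nonneg (hl : l ∈ Set.Icc 0 1) : 0 ≤ (1 - l) * (3 + 2 * l) :=
  mul_nonneg (by linarith [hl.2]) (by linarith [hl.1])

theorem coeffRT_cases (hl : l ∈ Set.Icc 0 1) :
    0 < (1 - l) * (3 + 2 * l) ∨ 1 - 6 * l < 0 := by
  rcases hl.2.eq_or_lt with rfl | hl₁
  · norm_num
  · exact Or.inl (mul_pos (by linarith) (by linarith [hl.1]))

theorem coeffR_pos : 0 < 3 - 10 * l * (1 - l) := by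
  nlinarith [sq_nonneg (2 * l - 1)]

theorem one_sub_mem_Icc (hl : l ∈ Set.Icc 0 1) : 1 - l ∈ Set.Icc 0 1 :=
  ⟨sub_nonneg.2 hl.2, sub_le_self 1 hl.1⟩

theorem curveRT_nonneg (hl : l ∈ Set.Icc 0 1) : 0 ≤ curveRT l :=
  threshold_nonneg (coeffRT_nonneg hl)

theorem curveRT_lt_one (hl : l ∈ Set.Icc 0 1) : curveRT l < 1 :=
  threshold_lt_one (coeffRT_nonneg hl)

theorem curveS_nonneg (hl : l ∈ Set.Icc 0 1) : 0 ≤ curveS l :=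
  curveRT_nonneg (one_sub_mem_Icc hl)

theorem curveS_lt_one (hl : l ∈ Set.Icc 0 1) : curveS l < 1 :=
  curveRT_lt_one (one_sub_mem_Icc hl)

theorem curveR_nonneg : 0 ≤ curveR l :=
  threshold_nonneg coeffR_pos.le

theorem curveR_lt_one : curveR l < 1 :=
  threshold_lt_one coeffR_pos.le

theorem curveRT_pos (hl : l ∈ Set.Ico 0 1) : 0 < curveRT l :=
  threshold_pos (mul_pos (sub_pos.2 hl.2) (by linarith [hl.1]))

theorem curveS_pos (hl : l ∈ Set.Ioc 0 1) : 0 < curveS l :=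
  curveRT_pos ⟨sub_nonneg.2 hl.2, sub_lt_self 1 hl.1⟩

theorem cmp_verticalForm_curveRT (hl : l ∈ Set.Icc 0 1) (hw : w ∈ Set.Icc 0 1) :
    cmp (verticalForm (1 - 6 * l) ((1 - l) * (3 + 2 * l)) w) 0 = cmp (curveRT l) w :=
  cmp_verticalForm (coeffRT_nonneg hl) (coeffRT_cases hl) hw

theorem cmp_verticalForm_curveR (hw : w ∈ Set.Icc 0 1) :
    cmp (verticalForm 1 (3 - 10 * l * (1 - l)) w) 0 = cmp (curveR l) w :=
  cmp_verticalForm coeffR_pos.le (Or.inl coeffR_pos) hw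

theorem continuousOn_curveRT : ContinuousOn curveRT (Set.Icc 0 1) :=
  continuousOn_threshold (by fun_prop) (by fun_prop) fun _ => coeffRT_nonneg

theorem continuousOn_curveS : ContinuousOn curveS (Set.Icc 0 1) :=
  continuousOn_curveRT.comp (by fun_prop) fun _ => one_sub_mem_Icc

theorem continuousOn_curveR : ContinuousOn curveR (Set.Icc 0 1) :=
  continuousOn_threshold (by fun_prop) (by fun_prop) fun _ _ => coeffR_pos.le

theorem curveRT_zero : curveRT 0 = 3 / 5 := by
  rw [curveRT, threshold_of_sq_eq (d := 5)] <;> norm_num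

theorem curveRT_one : curveRT 1 = 0 := by
  rw [curveRT, threshold_of_sq_eq (d := 5)] <;> norm_num

theorem curveS_zero : curveS 0 = 0 := by
  rw [curveS, sub_zero, curveRT_one]

theorem curveS_one : curveS 1 = 3 / 5 := by
  rw [curveS, sub_self, curveRT_zero]

theorem curveR_zero : curveR 0 = 3 / 5 := by
  rw [curveR, threshold_of_sq_eq (d := 5)] <;> norm_num

theorem curveR_one_sub : curveR (1 - l) = curveR l := by
  rw [curveR, curveR]
  congr 1
  ring

theorem curveR_one : curveR 1 = 3 / 5 := by
  rw [← curveR_zero, ← curveR_one_sub, sub_self]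

theorem curveS_half : curveS (1 / 2) = curveRT (1 / 2) := by
  rw [curveS]
  norm_num

theorem curveS_lt_curveRT (hl : l ∈ Set.Ico 0 (1 / 2)) : curveS l < curveRT l := by
  obtain ⟨hl₀, hl₁⟩ := hl
  have hl' : 1 - l ∈ Set.Icc (0 : ℝ) 1 := ⟨by linarith, by linarith⟩
  exact threshold_lt_threshold (coeffRT_nonneg hl') (coeffRT_cases hl') (by linarith)
    (by linarith)

theorem curveRT_lt_curveS (hl : l ∈ Set.Ioc (1 / 2) 1) : curveRT l < curveS l := by
  have := curveS_lt_curveRT (l := 1 - l) ⟨by linarith [hl.2], by linarith [hl.1]⟩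
  rwa [curveS, sub_sub_cancel] at this

theorem curveRT_lt_curveR (hl : l ∈ Set.Ioc 0 1) : curveRT l < curveR l := by
  have hl' : l ∈ Set.Icc (0 : ℝ) 1 := Set.Ioc_subset_Icc_self hl
  have hw₀ := curveRT_nonneg hl'
  have hw₁ := curveRT_lt_one hl'
  have hzero : verticalForm (1 - 6 * l) ((1 - l) * (3 + 2 * l)) (curveRT l) = 0 :=
    verticalForm_threshold (coeffRT_nonneg hl') (coeffRT_cases hl')
  refine (threshold_lt_threshold_iff (coeffRT_nonneg hl') coeffR_pos.le (Or.inl coeffR_pos)).2 ?_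
  change 0 < verticalForm _ _ (curveRT l)
  generalize curveRT l = w at *
  -- in terms of the gaps `a`, `w`, `c` both forms are short
  obtain ⟨a, ha⟩ : ∃ a, a = (1 - l) * (1 - w) := ⟨_, rfl⟩
  obtain ⟨c, hc⟩ : ∃ c, c = l * (1 - w) := ⟨_, rfl⟩
  have ha₀ : 0 ≤ a := ha ▸ mul_nonneg (sub_nonneg.2 hl.2) (sub_pos.2 hw₁).le
  have hc₀ : 0 < c := hc ▸ mul_pos hl.1 (sub_pos.2 hw₁)
  have hformRT : (3 * a - 2 * w) * (a + w) + 5 * c * (a - w) = 0 := by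
    rw [← hzero, verticalForm, ha, hc]
    ring
  have hformR : verticalForm 1 (3 - 10 * l * (1 - l)) w = 3 * c * (c + 2 * w - 3 * a) := by
    rw [← sub_zero (verticalForm _ _ w), ← hformRT, verticalForm, ha, hc]
    ring
  rw [hformR]
  refine mul_pos (by linarith) ?_
  by_contra! hcw
  have : c * (a + w) + 5 * c * (a - w) ≤ 0 := by
    rw [← hformRT]
    gcongr
    linarith
  nlinarith [mul_pos hc₀ hc₀, mul_nonneg hc₀.le (sub_nonneg.2 hcw)]

theorem curveS_lt_curveR (hl : l ∈ Set.Ico 0 1) : curveS l < curveR l := by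
  rw [← curveR_one_sub]
  exact curveRT_lt_curveR ⟨sub_pos.2 hl.2, sub_le_self 1 hl.1⟩

end Curves

section CriticalValues

variable {x : ℝ × ℝ}

theorem cmp_eval_eval_of_conic_eq {P : ℝ[X]} {y z y' z' k m n w : ℝ} (hyz : y < z)
    (hP : derivative P = C 5 * ((X - C y) * (X - C z) * (X - C y') * (X - C z'))) (hk : 0 < k)
    (hconic : conic y z y' z' = 2 * k ^ 2 * verticalForm m n w) :
    cmp (P.eval y) (P.eval z) = cmp (verticalForm m n w) 0 := by
  have hcmp := cmp_mul_pos_left (by positivity : 0 < 2 * k ^ 2) (verticalForm m n w) 0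
  rwa [mul_zero, ← hconic, ← cmp_eval_eval_of_derivative_eq hyz hP] at hcmp

theorem cmp_eval_chartR_chartT (hx : x ∈ openSquare) :
    cmp ((p (chart x)).eval (chartR x)) ((p (chart x)).eval (chartT x)) =
      cmp (curveRT x.1) x.2 := by
  have hx' := openSquare_subset_closedSquare hx
  obtain ⟨hrs, hst, -, hd⟩ := (hasOrderedCriticalPoints_chart_iff hx').2 hx
  rw [← cmp_verticalForm_curveRT hx'.1 hx'.2]
  refine cmp_eval_eval_of_conic_eq (y' := chartS x) (z' := 0) (hrs.trans hst)
    (hd.trans (by ring)) (chartScale_pos hx') ?_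
  rw [conic, chartR, chartS, chartT, verticalForm]
  ring

theorem cmp_eval_chartS_zero (hx : x ∈ openSquare) :
    cmp ((p (chart x)).eval (chartS x)) ((p (chart x)).eval 0) = cmp (curveS x.1) x.2 := by
  have hx' := openSquare_subset_closedSquare hx
  obtain ⟨-, hst, ht, hd⟩ := (hasOrderedCriticalPoints_chart_iff hx').2 hx
  rw [curveS, ← cmp_verticalForm_curveRT (one_sub_mem_Icc hx'.1) hx'.2]
  refine cmp_eval_eval_of_conic_eq (y' := chartR x) (z' := chartT x) (hst.trans ht)
    (hd.trans (by ring)) (chartScale_pos hx') ?_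
  rw [conic, chartR, chartS, chartT, verticalForm]
  ring

theorem cmp_eval_chartR_zero (hx : x ∈ openSquare) :
    cmp ((p (chart x)).eval (chartR x)) ((p (chart x)).eval 0) = cmp (curveR x.1) x.2 := by
  have hx' := openSquare_subset_closedSquare hx
  obtain ⟨hrs, hst, ht, hd⟩ := (hasOrderedCriticalPoints_chart_iff hx').2 hx
  rw [← cmp_verticalForm_curveR hx'.2]
  refine cmp_eval_eval_of_conic_eq (y' := chartS x) (z' := chartT x) ((hrs.trans hst).trans ht)
    (hd.trans (by ring)) (chartScale_pos hx') ?_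
  rw [conic, chartR, chartS, chartT, verticalForm]
  ring

theorem passport_chart_cases (hx : x ∈ openSquare) :
    (x.2 < curveS x.1 ∧ x.2 < curveRT x.1 ∧ passport (p (chart x)) = [4, 2, 3, 1]) ∨
    (x.2 < curveS x.1 ∧ curveRT x.1 = x.2 ∧ passport (p (chart x)) = [3, 2, 3, 1]) ∨
    (x.2 < curveS x.1 ∧ curveRT x.1 < x.2 ∧ passport (p (chart x)) = [3, 2, 4, 1]) ∨
    (curveS x.1 = x.2 ∧ x.2 < curveRT x.1 ∧ passport (p (chart x)) = [3, 1, 2, 1]) ∨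
    (curveS x.1 = x.2 ∧ curveRT x.1 = x.2 ∧ passport (p (chart x)) = [2, 1, 2, 1]) ∨
    (curveS x.1 = x.2 ∧ curveRT x.1 < x.2 ∧ passport (p (chart x)) = [2, 1, 3, 1]) ∨
    (curveS x.1 < x.2 ∧ x.2 < curveRT x.1 ∧ passport (p (chart x)) = [4, 1, 3, 2]) ∨
    (curveS x.1 < x.2 ∧ curveRT x.1 = x.2 ∧ passport (p (chart x)) = [3, 1, 3, 2]) ∨
    (curveS x.1 < x.2 ∧ x.2 < curveR x.1 ∧ curveRT x.1 < x.2 ∧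
      passport (p (chart x)) = [3, 1, 4, 2]) ∨
    (curveR x.1 = x.2 ∧ passport (p (chart x)) = [2, 1, 3, 2]) ∨
    (curveR x.1 < x.2 ∧ passport (p (chart x)) = [2, 1, 4, 3]) := by
  have hchart := (hasOrderedCriticalPoints_chart_iff (openSquare_subset_closedSquare hx)).2 hx
  have hRT := cmp_eval_chartR_chartT hx
  have hS := cmp_eval_chartS_zero hx
  have hR := cmp_eval_chartR_zero hx
  rw [hchart.passport_eq, ← lt_iff_lt_of_cmp_eq_cmp hRT, ← eq_iff_eq_of_cmp_eq_cmp hRT,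
    ← lt_iff_lt_of_cmp_eq_cmp (cmp_eq_cmp_symm.1 hRT), ← lt_iff_lt_of_cmp_eq_cmp hS,
    ← eq_iff_eq_of_cmp_eq_cmp hS, ← lt_iff_lt_of_cmp_eq_cmp (cmp_eq_cmp_symm.1 hS),
    ← lt_iff_lt_of_cmp_eq_cmp hR, ← eq_iff_eq_of_cmp_eq_cmp hR,
    ← lt_iff_lt_of_cmp_eq_cmp (cmp_eq_cmp_symm.1 hR)]
  exact ranks_cases_of_snake hchart.eval₂_lt_eval₁ hchart.eval₂_lt_eval₃ hchart.eval₄_lt_eval₃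

end CriticalValues

section ImageOfCompact

variable {X Y : Type*} {K U V : Set X} {Φ : X → Y}

theorem image_diff_of_injective_at (hinj : ∀ x ∈ U, ∀ y ∈ V, Φ x = Φ y → x = y) :
    Φ '' (U \ V) = Φ '' U \ Φ '' V := by
  ext y
  constructor
  · rintro ⟨x, ⟨hxU, hxV⟩, rfl⟩
    refine ⟨Set.mem_image_of_mem Φ hxU, ?_⟩
    rintro ⟨x', hx', heq⟩
    exact hxV (hinj x hxU x' hx' heq.symm ▸ hx')
  · rintro ⟨⟨x, hxU, rfl⟩, hnot⟩
    exact Set.mem_image_of_mem Φ ⟨hxU, fun hxV => hnot (Set.mem_image_of_mem Φ hxV)⟩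

variable [TopologicalSpace X] [TopologicalSpace Y] [T2Space Y]

theorem isOpen_image_of_isCompact (hK : IsCompact K) (hΦ : ContinuousOn Φ K)
    (hV : IsOpen (Φ '' V)) (hVK : V ⊆ K) (hUV : U ⊆ V) (hU : IsOpen U)
    (hinj : ∀ x ∈ U, ∀ y ∈ K, Φ x = Φ y → x = y) : IsOpen (Φ '' U) := by
  have hclosed : IsClosed (Φ '' (K \ U)) :=
    ((hK.diff hU).image_of_continuousOn (hΦ.mono Set.sdiff_subset)).isClosed
  convert hV.sdiff hclosed using 1
  ext y
  constructor
  · rintro ⟨x, hx, rfl⟩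
    refine ⟨Set.mem_image_of_mem Φ (hUV hx), ?_⟩
    rintro ⟨x', ⟨hx'K, hx'U⟩, heq⟩
    exact hx'U (hinj x hx x' hx'K heq.symm ▸ hx)
  · rintro ⟨⟨x, hx, rfl⟩, hnot⟩
    by_contra hxU
    exact hnot ⟨x, ⟨hVK hx, fun hx' => hxU (Set.mem_image_of_mem Φ hx')⟩, rfl⟩

theorem frontier_image_of_isCompact (hK : IsCompact (closure U)) (hΦ : ContinuousOn Φ (closure U))
    (hU : IsOpen U) (hΦU : IsOpen (Φ '' U))
    (hinj : ∀ x ∈ closure U, ∀ y ∈ U, Φ x = Φ y → x = y) :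
    frontier (Φ '' U) = Φ '' frontier U := by
  rw [hΦU.frontier_eq, hU.frontier_eq, ← image_closure_of_isCompact hK hΦ,
    image_diff_of_injective_at hinj]

end ImageOfCompact

section SimpleArc

variable {γ : Set (ℝ × ℝ)} {Y Z : ℝ × ℝ} {a b l : ℝ}

theorem IsSimpleArc.symm (hγ : IsSimpleArc γ Y Z) : IsSimpleArc γ Z Y := by
  obtain ⟨f, hf, rfl⟩ := hγ
  exact ⟨f.symm, hf.comp unitInterval.symm_bijective.injective, f.symm_range⟩

theorem IsSimpleArc.image {Φ : ℝ × ℝ → ℝ × ℝ} (hγ : IsSimpleArc γ Y Z) (hΦ : ContinuousOn Φ γ)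
    (hinj : Set.InjOn Φ γ) : IsSimpleArc (Φ '' γ) (Φ Y) (Φ Z) := by
  obtain ⟨f, hf, rfl⟩ := hγ
  exact ⟨f.map' hΦ, fun s t hst => hf (hinj ⟨s, rfl⟩ ⟨t, rfl⟩ hst), Set.range_comp Φ f⟩

theorem isSimpleArc_image_Icc {f : ℝ → ℝ × ℝ} (hab : a < b) (hf : ContinuousOn f (Set.Icc a b))
    (hinj : Set.InjOn f (Set.Icc a b)) : IsSimpleArc (f '' Set.Icc a b) (f a) (f b) := by
  have hline : (AffineMap.lineMap a b : ℝ → ℝ) '' unitInterval = Set.Icc a b := by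
    rw [← segment_eq_image_lineMap, segment_eq_Icc hab.le]
  have hmem (t : unitInterval) : AffineMap.lineMap a b (t : ℝ) ∈ Set.Icc a b :=
    hline ▸ Set.mem_image_of_mem _ t.2
  refine ⟨⟨⟨fun t => f (AffineMap.lineMap a b (t : ℝ)), ?_⟩, by simp, by simp⟩, ?_, ?_⟩
  · exact hf.comp_continuous (by fun_prop) hmem
  · intro s t hst
    exact Subtype.ext (AffineMap.lineMap_injective ℝ hab.ne (hinj (hmem s) (hmem t) hst))
  · change Set.range (fun t : unitInterval => f (AffineMap.lineMap a b (t : ℝ))) = _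
    rw [← hline, Set.image_image, Set.image_eq_range]

theorem isSimpleArc_graphOn {f : ℝ → ℝ} (hab : a < b) (hf : ContinuousOn f (Set.Icc a b)) :
    IsSimpleArc ((Set.Icc a b).graphOn f) (a, f a) (b, f b) :=
  isSimpleArc_image_Icc hab (by fun_prop) fun _ _ _ _ h => congrArg Prod.fst h

theorem isSimpleArc_singleton_prod (hab : a < b) :
    IsSimpleArc ({l} ×ˢ Set.Icc a b) (l, a) (l, b) := by
  rw [Set.singleton_prod]
  exact isSimpleArc_image_Icc hab (by fun_prop) fun _ _ _ _ h => congrArg Prod.snd h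

theorem IsCurvilinearTriangle.rotate {T UV VW WU : Set (ℝ × ℝ)} {U V W : ℝ × ℝ}
    (hT : IsCurvilinearTriangle T U V W UV VW WU) : IsCurvilinearTriangle T V W U VW WU UV := by
  obtain ⟨hUV, hVW, hWU, hV, hW, hU, hopen, hconn, hbdd, hfrontier⟩ := hT
  exact ⟨hVW, hWU, hUV, hW, hU, hV, hopen, hconn, hbdd, by
    rw [hfrontier, Set.union_assoc, Set.union_comm]⟩

end SimpleArc

section RegionBetween

variable {a b : ℝ} {f k : ℝ → ℝ}

/-- The points of the plane over the set `s` that lie weakly between the graphs of `f` and `k`;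
the closed counterpart of `regionBetween`. -/
def closedRegionBetween (f k : ℝ → ℝ) (s : Set ℝ) : Set (ℝ × ℝ) :=
  {x | x.1 ∈ s ∧ x.2 ∈ Set.Icc (f x.1) (k x.1)}

/-- The map of a rectangle `s ×ˢ [0, 1]` onto the closed region between the graphs of `f` and `k`
that is affine on each vertical segment. -/
noncomputable def fiberwiseLineMap (f k : ℝ → ℝ) (y : ℝ × ℝ) : ℝ × ℝ :=
  (y.1, AffineMap.lineMap (f y.1) (k y.1) y.2)

theorem image_fiberwiseLineMap_prod (s t : Set ℝ) : fiberwiseLineMap f k '' (s ×ˢ t) =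
    {x | x.1 ∈ s ∧ x.2 ∈ (AffineMap.lineMap (f x.1) (k x.1) : ℝ → ℝ) '' t} := by
  ext ⟨l, w⟩
  constructor
  · rintro ⟨y, ⟨hy₁, hy₂⟩, heq⟩
    obtain ⟨rfl, rfl⟩ := Prod.ext_iff.1 heq
    exact ⟨hy₁, _, hy₂, rfl⟩
  · rintro ⟨hl, v, hv, hw⟩
    exact ⟨(l, v), ⟨hl, hv⟩, Prod.ext rfl hw⟩

theorem image_fiberwiseLineMap_Ioo (hfk : ∀ l ∈ Set.Ioo a b, f l < k l) :
    fiberwiseLineMap f k '' (Set.Ioo a b ×ˢ Set.Ioo 0 1) = regionBetween f k (Set.Ioo a b) := by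
  rw [image_fiberwiseLineMap_prod]
  ext x
  refine and_congr_right fun hl => ?_
  rw [← openSegment_eq_image_lineMap, openSegment_eq_Ioo (hfk _ hl)]

theorem image_fiberwiseLineMap_Icc (hfk : ∀ l ∈ Set.Icc a b, f l ≤ k l) :
    fiberwiseLineMap f k '' (Set.Icc a b ×ˢ Set.Icc 0 1) =
      closedRegionBetween f k (Set.Icc a b) := by
  rw [image_fiberwiseLineMap_prod]
  ext x
  refine and_congr_right fun hl => ?_
  rw [← segment_eq_image_lineMap, segment_eq_Icc (hfk _ hl)]

variable (hf : ContinuousOn f (Set.Icc a b)) (hk : ContinuousOn k (Set.Icc a b))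
include hf hk

theorem continuousOn_fiberwiseLineMap (t : Set ℝ) :
    ContinuousOn (fiberwiseLineMap f k) (Set.Icc a b ×ˢ t) := by
  have hfst : Set.MapsTo Prod.fst (Set.Icc a b ×ˢ t) (Set.Icc a b) := fun _ hy => hy.1
  have hf' : ContinuousOn (fun y : ℝ × ℝ => f y.1) (Set.Icc a b ×ˢ t) :=
    hf.comp continuousOn_fst hfst
  have hk' : ContinuousOn (fun y : ℝ × ℝ => k y.1) (Set.Icc a b ×ˢ t) :=
    hk.comp continuousOn_fst hfst
  unfold fiberwiseLineMap
  simp only [AffineMap.lineMap_apply_module, smul_eq_mul]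
  exact continuousOn_fst.prodMk
    (((continuousOn_const.sub continuousOn_snd).mul hf').add (continuousOn_snd.mul hk'))

theorem isOpen_regionBetween_Ioo : IsOpen (regionBetween f k (Set.Ioo a b)) := by
  have hU : IsOpen (Set.Ioo a b ×ˢ Set.univ : Set (ℝ × ℝ)) := isOpen_Ioo.prod isOpen_univ
  have hfst : Set.MapsTo Prod.fst (Set.Ioo a b ×ˢ Set.univ : Set (ℝ × ℝ)) (Set.Icc a b) :=
    fun _ hx => Set.Ioo_subset_Icc_self hx.1
  have hf' : ContinuousOn (fun x : ℝ × ℝ => x.2 - f x.1) (Set.Ioo a b ×ˢ Set.univ) :=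
    continuousOn_snd.sub (hf.comp continuousOn_fst hfst)
  have hk' : ContinuousOn (fun x : ℝ × ℝ => k x.1 - x.2) (Set.Ioo a b ×ˢ Set.univ) :=
    (hk.comp continuousOn_fst hfst).sub continuousOn_snd
  have hlower := hf'.isOpen_inter_preimage hU (isOpen_Ioi (a := (0 : ℝ)))
  have hupper := hk'.isOpen_inter_preimage hU (isOpen_Ioi (a := (0 : ℝ)))
  convert hlower.inter hupper using 1
  ext x
  simp only [regionBetween, Set.mem_ofPred_eq, Set.mem_inter_iff, Set.mem_prod, Set.mem_univ,
    Set.mem_preimage, Set.mem_Ioi, Set.mem_Ioo, sub_pos]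
  tauto

theorem isConnected_regionBetween_Ioo (hab : a < b) (hfk : ∀ l ∈ Set.Ioo a b, f l < k l) :
    IsConnected (regionBetween f k (Set.Ioo a b)) := by
  rw [← image_fiberwiseLineMap_Ioo hfk]
  exact ((isConnected_Ioo hab).prod (isConnected_Ioo zero_lt_one)).image _
    ((continuousOn_fiberwiseLineMap hf hk _).mono
      (Set.prod_mono Set.Ioo_subset_Icc_self subset_rfl))

theorem closure_regionBetween_Ioo (hab : a < b) (hfk : ∀ l ∈ Set.Ioo a b, f l < k l)
    (hfk' : ∀ l ∈ Set.Icc a b, f l ≤ k l) :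
    closure (regionBetween f k (Set.Ioo a b)) = closedRegionBetween f k (Set.Icc a b) := by
  have hclosure : closure (Set.Ioo a b ×ˢ Set.Ioo 0 1) = Set.Icc a b ×ˢ Set.Icc (0 : ℝ) 1 := by
    rw [closure_prod_eq, closure_Ioo hab.ne, closure_Ioo zero_ne_one]
  rw [← image_fiberwiseLineMap_Ioo hfk, ← image_fiberwiseLineMap_Icc hfk', ← hclosure]
  exact (image_closure_of_isCompact (hclosure ▸ isCompact_Icc.prod isCompact_Icc)
    (hclosure ▸ continuousOn_fiberwiseLineMap hf hk _)).symm

theorem frontier_regionBetween_Ioo (hab : a < b) (hfk : ∀ l ∈ Set.Ioo a b, f l < k l)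
    (hfk' : ∀ l ∈ Set.Icc a b, f l ≤ k l) :
    frontier (regionBetween f k (Set.Ioo a b)) =
      (Set.Icc a b).graphOn f ∪ (Set.Icc a b).graphOn k ∪
        {a} ×ˢ Set.Icc (f a) (k a) ∪ {b} ×ˢ Set.Icc (f b) (k b) := by
  rw [(isOpen_regionBetween_Ioo hf hk).frontier_eq, closure_regionBetween_Ioo hf hk hab hfk hfk']
  ext ⟨l, w⟩
  have := hfk' l
  simp only [closedRegionBetween, regionBetween, Set.mem_sdiff, Set.mem_ofPred_eq, Set.mem_union,
    Set.mem_graphOn, Set.mem_prod, Set.mem_singleton_iff, Set.mem_Icc, Set.mem_Ioo] at this ⊢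
  grind

end RegionBetween

section TriangleBetweenGraphs

variable {a b c : ℝ} {f k : ℝ → ℝ}

theorem isBounded_regionBetween_Ioo (hf : ContinuousOn f (Set.Icc a b))
    (hk : ContinuousOn k (Set.Icc a b)) (hfk : ∀ l ∈ Set.Ioo a b, f l < k l) :
    Bornology.IsBounded (regionBetween f k (Set.Ioo a b)) := by
  rw [← image_fiberwiseLineMap_Ioo hfk]
  exact ((isCompact_Icc.prod isCompact_Icc).image_of_continuousOn
    (continuousOn_fiberwiseLineMap hf hk _)).isBounded.subset
    (Set.image_mono (Set.prod_mono Set.Ioo_subset_Icc_self Set.Ioo_subset_Icc_self))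

theorem isCurvilinearTriangle_regionBetween {U V W : ℝ × ℝ} {UV VW WU : Set (ℝ × ℝ)} (hab : a < b)
    (hf : ContinuousOn f (Set.Icc a b)) (hk : ContinuousOn k (Set.Icc a b))
    (hfk : ∀ l ∈ Set.Ioo a b, f l < k l) (hfk' : ∀ l ∈ Set.Icc a b, f l ≤ k l)
    (hUV : IsSimpleArc UV U V) (hVW : IsSimpleArc VW V W) (hWU : IsSimpleArc WU W U)
    (hV : UV ∩ VW = {V}) (hW : VW ∩ WU = {W}) (hU : WU ∩ UV = {U})
    (hsides : (Set.Icc a b).graphOn f ∪ (Set.Icc a b).graphOn k ∪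
      {a} ×ˢ Set.Icc (f a) (k a) ∪ {b} ×ˢ Set.Icc (f b) (k b) = UV ∪ VW ∪ WU) :
    IsCurvilinearTriangle (regionBetween f k (Set.Ioo a b)) U V W UV VW WU :=
  ⟨hUV, hVW, hWU, hV, hW, hU, isOpen_regionBetween_Ioo hf hk,
    isConnected_regionBetween_Ioo hf hk hab hfk, isBounded_regionBetween_Ioo hf hk hfk,
    (frontier_regionBetween_Ioo hf hk hab hfk hfk').trans hsides⟩

theorem isCurvilinearTriangle_regionBetween_of_eq_left (hab : a < b)
    (hf : ContinuousOn f (Set.Icc a b)) (hk : ContinuousOn k (Set.Icc a b)) (ha : f a = k a)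
    (hfk : ∀ l ∈ Set.Ioc a b, f l < k l) :
    IsCurvilinearTriangle (regionBetween f k (Set.Ioo a b)) (b, f b) (b, k b) (a, k a)
      ({b} ×ˢ Set.Icc (f b) (k b)) ((Set.Icc a b).graphOn k) ((Set.Icc a b).graphOn f) := by
  have hb := hfk b ⟨hab, le_rfl⟩
  refine isCurvilinearTriangle_regionBetween hab hf hk (fun l hl => hfk l ⟨hl.1, hl.2.le⟩) ?_
    (isSimpleArc_singleton_prod hb) (isSimpleArc_graphOn hab hk).symm
    (ha ▸ isSimpleArc_graphOn hab hf) ?_ ?_ ?_ ?_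
  · grind
  all_goals
    ext ⟨l, w⟩
    have := hfk l
    simp only [Set.mem_inter_iff, Set.mem_union, Set.mem_graphOn, Set.mem_prod,
      Set.mem_singleton_iff, Set.mem_Icc, Set.mem_Ioc, Prod.mk.injEq] at this ⊢
    grind

theorem isCurvilinearTriangle_regionBetween_of_eq_right (hab : a < b)
    (hf : ContinuousOn f (Set.Icc a b)) (hk : ContinuousOn k (Set.Icc a b)) (hb : f b = k b)
    (hfk : ∀ l ∈ Set.Ico a b, f l < k l) :
    IsCurvilinearTriangle (regionBetween f k (Set.Ioo a b)) (a, f a) (a, k a) (b, k b)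
      ({a} ×ˢ Set.Icc (f a) (k a)) ((Set.Icc a b).graphOn k) ((Set.Icc a b).graphOn f) := by
  have ha := hfk a ⟨le_rfl, hab⟩
  refine isCurvilinearTriangle_regionBetween hab hf hk (fun l hl => hfk l ⟨hl.1.le, hl.2⟩) ?_
    (isSimpleArc_singleton_prod ha) (isSimpleArc_graphOn hab hk)
    (hb ▸ isSimpleArc_graphOn hab hf).symm ?_ ?_ ?_ ?_
  · grind
  all_goals
    ext ⟨l, w⟩
    have := hfk l
    simp only [Set.mem_inter_iff, Set.mem_union, Set.mem_graphOn, Set.mem_prod,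
      Set.mem_singleton_iff, Set.mem_Icc, Set.mem_Ico, Prod.mk.injEq] at this ⊢
    grind

variable (hac : a < c) (hcb : c < b) (hf : ContinuousOn f (Set.Icc a b))
  (hk : ContinuousOn k (Set.Icc a b)) (ha : f a = k a) (hb : f b = k b)
  (hfk : ∀ l ∈ Set.Ioo a b, f l < k l)
include hac hcb hf hk ha hb hfk

theorem isCurvilinearTriangle_regionBetween_of_vertex_above :
    IsCurvilinearTriangle (regionBetween f k (Set.Ioo a b)) (a, f a) (b, f b) (c, k c)
      ((Set.Icc a b).graphOn f) ((Set.Icc c b).graphOn k) ((Set.Icc a c).graphOn k) := by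
  refine isCurvilinearTriangle_regionBetween (hac.trans hcb) hf hk hfk ?_
    (isSimpleArc_graphOn (hac.trans hcb) hf)
    (hb ▸ isSimpleArc_graphOn hcb (hk.mono (Set.Icc_subset_Icc_left hac.le))).symm
    (ha ▸ isSimpleArc_graphOn hac (hk.mono (Set.Icc_subset_Icc_right hcb.le))).symm ?_ ?_ ?_ ?_
  · grind
  all_goals
    ext ⟨l, w⟩
    have := hfk l
    simp only [Set.mem_inter_iff, Set.mem_union, Set.mem_graphOn, Set.mem_prod,
      Set.mem_singleton_iff, Set.mem_Icc, Set.mem_Ioo, Prod.mk.injEq] at this ⊢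
    grind

theorem isCurvilinearTriangle_regionBetween_of_vertex_below :
    IsCurvilinearTriangle (regionBetween f k (Set.Ioo a b)) (a, k a) (b, k b) (c, f c)
      ((Set.Icc a b).graphOn k) ((Set.Icc c b).graphOn f) ((Set.Icc a c).graphOn f) := by
  refine isCurvilinearTriangle_regionBetween (hac.trans hcb) hf hk hfk ?_
    (isSimpleArc_graphOn (hac.trans hcb) hk)
    (hb ▸ isSimpleArc_graphOn hcb (hf.mono (Set.Icc_subset_Icc_left hac.le))).symm
    (ha ▸ isSimpleArc_graphOn hac (hf.mono (Set.Icc_subset_Icc_right hcb.le))).symm ?_ ?_ ?_ ?_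
  · grind
  all_goals
    ext ⟨l, w⟩
    have := hfk l
    simp only [Set.mem_inter_iff, Set.mem_union, Set.mem_graphOn, Set.mem_prod,
      Set.mem_singleton_iff, Set.mem_Icc, Set.mem_Ioo, Prod.mk.injEq] at this ⊢
    grind

end TriangleBetweenGraphs

section ChartTransport

variable {U T UV VW WU : Set (ℝ × ℝ)} {V W Z : ℝ × ℝ}

theorem isOpen_image_chart (hU : IsOpen U) (hUsub : U ⊆ openSquare) : IsOpen (chart '' U) :=
  isOpen_image_of_isCompact isCompact_closedSquare continuousOn_chart
    (image_chart_openSquare ▸ isOpen_region) openSquare_subset_closedSquare hUsub hU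
    fun _ hx _ hy => eq_of_chart_eq (openSquare_subset_closedSquare (hUsub hx)) hy (hUsub hx).2.2

theorem closure_subset_closedSquare (hUsub : U ⊆ openSquare) : closure U ⊆ closedSquare :=
  closure_minimal (hUsub.trans openSquare_subset_closedSquare) isCompact_closedSquare.isClosed

theorem frontier_image_chart (hU : IsOpen U) (hUsub : U ⊆ openSquare) :
    frontier (chart '' U) = chart '' frontier U := by
  have hclosure := closure_subset_closedSquare hUsub
  refine frontier_image_of_isCompact (isCompact_closedSquare.of_isClosed_subset isClosed_closure
    hclosure) (continuousOn_chart.mono hclosure) hU (isOpen_image_chart hU hUsub) ?_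
  intro x hx y hy hxy
  exact (eq_of_chart_eq (openSquare_subset_closedSquare (hUsub hy)) (hclosure hx) (hUsub hy).2.2
    hxy.symm).symm

theorem isConnected_image_chart (hU : IsConnected U) (hUsub : U ⊆ openSquare) :
    IsConnected (chart '' U) :=
  hU.image _ (continuousOn_chart.mono (hUsub.trans openSquare_subset_closedSquare))

theorem isBounded_image_chart (hUsub : U ⊆ openSquare) : Bornology.IsBounded (chart '' U) :=
  (isCompact_closedSquare.image_of_continuousOn continuousOn_chart).isBounded.subset
    (Set.image_mono (hUsub.trans openSquare_subset_closedSquare))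

theorem injOn_chart : Set.InjOn chart (Set.Icc 0 1 ×ˢ Set.Ico 0 1) :=
  fun _ hx _ hy => eq_of_chart_eq ⟨hx.1, Set.Ico_subset_Icc_self hx.2⟩
    ⟨hy.1, Set.Ico_subset_Icc_self hy.2⟩ hx.2.2

theorem IsCurvilinearTriangle.image_chart (hT : IsCurvilinearTriangle T V W Z UV VW WU)
    (hTsub : T ⊆ openSquare) (hfrontier : frontier T ⊆ Set.Icc 0 1 ×ˢ Set.Ico 0 1) :
    IsCurvilinearTriangle (chart '' T) (chart V) (chart W) (chart Z)
      (chart '' UV) (chart '' VW) (chart '' WU) := by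
  obtain ⟨hUV, hVW, hWU, hW, hZ, hV, hopen, hconn, -, hsides⟩ := hT
  rw [hsides, Set.union_subset_iff, Set.union_subset_iff] at hfrontier
  obtain ⟨⟨hsubUV, hsubVW⟩, hsubWU⟩ := hfrontier
  have hcont : ContinuousOn chart (Set.Icc 0 1 ×ˢ Set.Ico 0 1) :=
    continuousOn_chart.mono (Set.prod_mono subset_rfl Set.Ico_subset_Icc_self)
  refine ⟨hUV.image (hcont.mono hsubUV) (injOn_chart.mono hsubUV),
    hVW.image (hcont.mono hsubVW) (injOn_chart.mono hsubVW),
    hWU.image (hcont.mono hsubWU) (injOn_chart.mono hsubWU), ?_, ?_, ?_,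
    isOpen_image_chart hopen hTsub, isConnected_image_chart hconn hTsub,
    isBounded_image_chart hTsub, ?_⟩
  · rw [← injOn_chart.image_inter hsubUV hsubVW, hW, Set.image_singleton]
  · rw [← injOn_chart.image_inter hsubVW hsubWU, hZ, Set.image_singleton]
  · rw [← injOn_chart.image_inter hsubWU hsubUV, hV, Set.image_singleton]
  · rw [frontier_image_chart hopen hTsub, hsides, Set.image_union, Set.image_union]

theorem chart_ptO : chart (0, 0) = ptO := by
  norm_num [chart, chartR, chartS, chartT, chartScale, ptO]

theorem chart_ptA : chart (1, 0) = ptA := by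
  norm_num [chart, chartR, chartS, chartT, chartScale, ptA]

theorem chart_ptB (l : ℝ) : chart (l, 1) = ptB := by
  norm_num [chart, chartR, chartS, chartT, chartScale, ptB]

theorem chart_ptD : chart (0, 3 / 5) = ptD := by
  norm_num [chart, chartR, chartS, chartT, chartScale, ptD]

theorem chart_ptE : chart (1, 3 / 5) = ptE := by
  norm_num [chart, chartR, chartS, chartT, chartScale, ptE]

end ChartTransport

section CollapsedTop

variable {a b l : ℝ} {f : ℝ → ℝ} {x y : ℝ × ℝ}

theorem eq_or_of_chart_eq (hx : x ∈ closedSquare) (hy : y ∈ closedSquare)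
    (hxy : chart x = chart y) : x = y ∨ x.2 = 1 ∧ y.2 = 1 := by
  rcases hx.2.2.lt_or_eq with hx₁ | hx₁
  · exact Or.inl (eq_of_chart_eq hx hy hx₁ hxy)
  rcases hy.2.2.lt_or_eq with hy₁ | hy₁
  · exact Or.inl (eq_of_chart_eq hy hx hy₁ hxy.symm).symm
  · exact Or.inr ⟨hx₁, hy₁⟩

theorem isSimpleArc_image_chart_vertical (hl : l ∈ Set.Icc 0 1) (ha : 0 ≤ a) (hab : a < b)
    (hb : b ≤ 1) :
    IsSimpleArc (chart '' ({l} ×ˢ Set.Icc a b)) (chart (l, a)) (chart (l, b)) := by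
  have hsub : {l} ×ˢ Set.Icc a b ⊆ closedSquare :=
    Set.prod_mono (Set.singleton_subset_iff.2 hl) (Set.Icc_subset_Icc ha hb)
  refine (isSimpleArc_singleton_prod hab).image (continuousOn_chart.mono hsub) ?_
  intro x hx y hy hxy
  rcases eq_or_of_chart_eq (hsub hx) (hsub hy) hxy with heq | ⟨hx₁, hy₁⟩
  · exact heq
  · exact Prod.ext (hx.1.trans hy.1.symm) (hx₁.trans hy₁.symm)

theorem image_chart_vertical_zero (ha : 0 ≤ a) (hab : a ≤ b) (hb : b ≤ 1) :
    chart '' ({0} ×ˢ Set.Icc a b) = segment ℝ (chart (0, a)) (chart (0, b)) := by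
  let φ : ℝ → ℝ := fun w => 9 * w / (1 + w) ^ 2
  have hchart {w : ℝ} (_ : 0 ≤ w) : chart (0, w) = (φ w, 0) := by
    simp only [φ, chart, chartR, chartS, chartT, chartScale]
    field_simp
    norm_num [mul_comm]
  have hmono : MonotoneOn φ (Set.Icc a b) := by
    intro w hw w' hw' hww'
    have hw₀ := ha.trans hw.1
    have hw₀' := ha.trans hw'.1
    simp only [φ]
    rw [div_le_div_iff₀ (by positivity) (by positivity)]
    nlinarith [mul_nonneg (sub_nonneg.2 hww')
      (sub_nonneg.2 (mul_le_one₀ (hw.2.trans hb) hw₀' (hw'.2.trans hb)))]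
  have hcont : ContinuousOn φ (Set.Icc a b) :=
    ContinuousOn.div (by fun_prop) (by fun_prop) fun w hw =>
      pow_ne_zero 2 (by linarith [ha.trans hw.1])
  have himage : φ '' Set.Icc a b = Set.Icc (φ a) (φ b) :=
    (hmono.image_Icc_subset).antisymm (intermediate_value_Icc hab hcont)
  have hle : φ a ≤ φ b := hmono ⟨le_rfl, hab⟩ ⟨hab, le_rfl⟩ hab
  rw [hchart ha, hchart (ha.trans hab), ← Prod.image_mk_segment_left, segment_eq_Icc hle,
    ← himage, Set.singleton_prod, Set.image_image, Set.image_image]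
  exact Set.image_congr fun w hw => hchart (ha.trans hw.1)

theorem image_chart_inter {S G : Set (ℝ × ℝ)} (hS : S ⊆ closedSquare)
    (hG : G ⊆ Set.Icc 0 1 ×ˢ Set.Ico 0 1) : chart '' S ∩ chart '' G = chart '' (S ∩ G) :=
  (Set.image_inter_on fun _ hx _ hy => eq_of_chart_eq
    ⟨(hG hx).1, Set.Ico_subset_Icc_self (hG hx).2⟩ (hS hy) (hG hx).2.2).symm

theorem image_chart_vertical_inter_vertical {a₀ a₁ : ℝ} (ha₀ : a₀ ∈ Set.Icc 0 1)
    (ha₁ : a₁ ∈ Set.Icc 0 1) :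
    chart '' ({1} ×ˢ Set.Icc a₁ 1) ∩ chart '' ({0} ×ˢ Set.Icc a₀ 1) = {ptB} := by
  ext u
  constructor
  · rintro ⟨⟨x, ⟨hx₁, hx₂⟩, rfl⟩, y, ⟨hy₁, hy₂⟩, hxy⟩
    rw [Set.mem_singleton_iff] at hx₁ hy₁
    rcases eq_or_of_chart_eq ⟨by simp [hx₁], ha₁.1.trans hx₂.1, hx₂.2⟩
      ⟨by simp [hy₁], ha₀.1.trans hy₂.1, hy₂.2⟩ hxy.symm with rfl | ⟨hx, -⟩
    · exact absurd (hx₁.symm.trans hy₁) one_ne_zero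
    · rw [Set.mem_singleton_iff, show x = (1, 1) from Prod.ext hx₁ hx, chart_ptB]
  · rintro rfl
    exact ⟨⟨(1, 1), ⟨rfl, ha₁.2, le_rfl⟩, chart_ptB 1⟩, (0, 1), ⟨rfl, ha₀.2, le_rfl⟩, chart_ptB 0⟩

variable (hf : ∀ l ∈ Set.Icc 0 1, f l ∈ Set.Ico 0 1)
include hf

theorem graphOn_subset : (Set.Icc 0 1).graphOn f ⊆ Set.Icc 0 1 ×ˢ Set.Ico 0 1 := by
  intro x hx
  obtain ⟨hx₁, hx₂⟩ := Set.mem_graphOn.1 hx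
  exact ⟨hx₁, hx₂ ▸ hf _ hx₁⟩

theorem image_chart_graphOn_one_subset :
    chart '' (Set.Icc 0 1).graphOn 1 ⊆ chart '' ({0} ×ˢ Set.Icc (f 0) 1) := by
  rintro _ ⟨x, hx, rfl⟩
  refine ⟨(0, 1), ⟨rfl, (hf 0 (by simp)).2.le, le_rfl⟩, ?_⟩
  rw [chart_ptB, show x = (x.1, 1) from Prod.ext rfl (Set.mem_graphOn.1 hx).2.symm, chart_ptB]

theorem image_chart_vertical_inter_graphOn (hl : l ∈ Set.Icc 0 1) :
    chart '' ({l} ×ˢ Set.Icc (f l) 1) ∩ chart '' (Set.Icc 0 1).graphOn f = {chart (l, f l)} := by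
  have hfl := hf l hl
  rw [image_chart_inter ?_ (graphOn_subset hf), ← Set.image_singleton]
  · congr 1
    ext ⟨l', w⟩
    simp only [Set.mem_inter_iff, Set.mem_graphOn, Set.mem_prod, Set.mem_singleton_iff,
      Set.mem_Icc, Set.mem_Ico, Prod.mk.injEq] at hl hfl ⊢
    grind
  · exact Set.prod_mono (Set.singleton_subset_iff.2 hl) (Set.Icc_subset_Icc_left hfl.1)

theorem isCurvilinearTriangle_image_chart_above_graph (hfcont : ContinuousOn f (Set.Icc 0 1)) :
    IsCurvilinearTriangle (chart '' regionBetween f 1 (Set.Ioo 0 1)) ptB (chart (0, f 0))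
      (chart (1, f 1)) (chart '' ({0} ×ˢ Set.Icc (f 0) 1)) (chart '' (Set.Icc 0 1).graphOn f)
      (chart '' ({1} ×ˢ Set.Icc (f 1) 1)) := by
  have h₀ : (0 : ℝ) ∈ Set.Icc 0 1 := by simp
  have h₁ : (1 : ℝ) ∈ Set.Icc 0 1 := by simp
  have hone : ContinuousOn (1 : ℝ → ℝ) (Set.Icc 0 1) := continuousOn_const
  have hlt : ∀ l ∈ Set.Ioo 0 1, f l < (1 : ℝ → ℝ) l :=
    fun l hl => (hf l (Set.Ioo_subset_Icc_self hl)).2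
  have hopen := isOpen_regionBetween_Ioo hfcont hone
  have hsub : regionBetween f 1 (Set.Ioo 0 1) ⊆ openSquare := fun x hx =>
    ⟨hx.1, (hf _ (Set.Ioo_subset_Icc_self hx.1)).1.trans_lt hx.2.1, hx.2.2⟩
  have hside {l : ℝ} (hl : l ∈ Set.Icc 0 1) :
      IsSimpleArc (chart '' ({l} ×ˢ Set.Icc (f l) 1)) (chart (l, f l)) ptB :=
    chart_ptB l ▸ isSimpleArc_image_chart_vertical hl (hf l hl).1 (hf l hl).2 le_rfl
  refine ⟨(hside h₀).symm, ?_, hside h₁, image_chart_vertical_inter_graphOn hf h₀, ?_,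
    image_chart_vertical_inter_vertical (Set.Ico_subset_Icc_self (hf 0 h₀))
      (Set.Ico_subset_Icc_self (hf 1 h₁)),
    isOpen_image_chart hopen hsub,
    isConnected_image_chart (isConnected_regionBetween_Ioo hfcont hone zero_lt_one hlt) hsub,
    isBounded_image_chart hsub, ?_⟩
  · exact (isSimpleArc_graphOn zero_lt_one hfcont).image (continuousOn_chart.mono
      ((graphOn_subset hf).trans (Set.prod_mono subset_rfl Set.Ico_subset_Icc_self)))
      (injOn_chart.mono (graphOn_subset hf))
  · rw [Set.inter_comm, image_chart_vertical_inter_graphOn hf h₁]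
  · rw [frontier_image_chart hopen hsub, frontier_regionBetween_Ioo hfcont hone zero_lt_one hlt
      fun l hl => (hf l hl).2.le]
    simp only [Set.image_union, Pi.one_apply]
    rw [Set.union_comm (chart '' (Set.Icc 0 1).graphOn f),
      Set.union_right_comm (chart '' (Set.Icc 0 1).graphOn 1),
      Set.union_eq_self_of_subset_left (image_chart_graphOn_one_subset hf)]

end CollapsedTop

section Cells

/-- The common point `F` of the curves `g = 0` and `h = 0`, in the chart. -/
noncomputable def pointF : ℝ × ℝ := (1 / 2, curveRT (1 / 2))

/-- The side `OA` of the triangle `OAB`, in the chart. -/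
def arcOA : Set (ℝ × ℝ) := (Set.Icc 0 1).graphOn 0

/-- The arc `AE` of the side `AB`, in the chart. -/
def arcAE : Set (ℝ × ℝ) := {1} ×ˢ Set.Icc 0 (3 / 5)

/-- The arc `EB` of the side `AB`, in the chart. -/
def arcEB : Set (ℝ × ℝ) := {1} ×ˢ Set.Icc (3 / 5) 1

/-- The arc `AF` of the curve `g = 0`, in the chart. -/
def arcAF : Set (ℝ × ℝ) := (Set.Icc (1 / 2) 1).graphOn curveRT

/-- The arc `FD` of the curve `g = 0`, in the chart. -/
def arcFD : Set (ℝ × ℝ) := (Set.Icc 0 (1 / 2)).graphOn curveRT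

/-- The arc `OF` of the curve `h = 0`, in the chart. -/
def arcOF : Set (ℝ × ℝ) := (Set.Icc 0 (1 / 2)).graphOn curveS

/-- The arc `FE` of the curve `h = 0`, in the chart. -/
def arcFE : Set (ℝ × ℝ) := (Set.Icc (1 / 2) 1).graphOn curveS

/-- The arc `ED` of the curve `h = 0`, in the chart. -/
def arcED : Set (ℝ × ℝ) := (Set.Icc 0 1).graphOn curveR

/-- The triangle `OAF`, in the chart. -/
def cellOAF : Set (ℝ × ℝ) := regionBetween 0 (fun l => min (curveS l) (curveRT l)) (Set.Ioo 0 1)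

/-- The triangle `AEF`, in the chart. -/
def cellAEF : Set (ℝ × ℝ) := regionBetween curveRT curveS (Set.Ioo (1 / 2) 1)

/-- The triangle `ODF`, in the chart. -/
def cellODF : Set (ℝ × ℝ) := regionBetween curveS curveRT (Set.Ioo 0 (1 / 2))

/-- The triangle `DEF`, in the chart. -/
def cellDEF : Set (ℝ × ℝ) :=
  regionBetween (fun l => max (curveS l) (curveRT l)) curveR (Set.Ioo 0 1)

/-- The triangle `BDE`, in the chart. -/
def cellBDE : Set (ℝ × ℝ) := regionBetween curveR 1 (Set.Ioo 0 1)

variable {l : ℝ} {x : ℝ × ℝ}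

theorem curveRT_pos_of_mem (hl : l ∈ Set.Ioo 0 1) : 0 < curveRT l :=
  curveRT_pos (Set.Ioo_subset_Ico_self hl)

theorem curveS_pos_of_mem (hl : l ∈ Set.Ioo 0 1) : 0 < curveS l :=
  curveS_pos (Set.Ioo_subset_Ioc_self hl)

theorem curveS_le_curveRT_iff (hl : l ∈ Set.Icc 0 1) : curveS l ≤ curveRT l ↔ l ≤ 1 / 2 := by
  refine ⟨fun h => ?_, fun h => ?_⟩
  · by_contra! hl'
    exact (curveRT_lt_curveS ⟨hl', hl.2⟩).not_ge h
  · rcases h.lt_or_eq with hl' | rfl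
    · exact (curveS_lt_curveRT ⟨hl.1, hl'⟩).le
    · exact curveS_half.le

theorem curveRT_le_curveS_iff (hl : l ∈ Set.Icc 0 1) : curveRT l ≤ curveS l ↔ 1 / 2 ≤ l := by
  have := curveS_le_curveRT_iff (one_sub_mem_Icc hl)
  rw [curveS, sub_sub_cancel] at this
  rw [curveS, this]
  constructor <;> intro <;> linarith

theorem mem_cellOAF : x ∈ cellOAF ↔ x ∈ openSquare ∧ x.2 < curveS x.1 ∧ x.2 < curveRT x.1 := by
  constructor
  · rintro ⟨hl, hw₀, hw₁⟩
    rw [lt_min_iff] at hw₁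
    exact ⟨⟨hl, hw₀, hw₁.1.trans (curveS_lt_one (Set.Ioo_subset_Icc_self hl))⟩, hw₁⟩
  · rintro ⟨⟨hl, hw⟩, hw₁⟩
    exact ⟨hl, hw.1, lt_min_iff.2 hw₁⟩

theorem mem_cellAEF : x ∈ cellAEF ↔ x ∈ openSquare ∧ x.2 < curveS x.1 ∧ curveRT x.1 < x.2 := by
  constructor
  · rintro ⟨⟨hl₀, hl₁⟩, hw₀, hw₁⟩
    have hl : x.1 ∈ Set.Ioo 0 1 := ⟨by linarith, hl₁⟩
    exact ⟨⟨hl, (curveRT_pos_of_mem hl).trans hw₀,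
      hw₁.trans (curveS_lt_one (Set.Ioo_subset_Icc_self hl))⟩, hw₁, hw₀⟩
  · rintro ⟨⟨hl, -⟩, hw₁, hw₀⟩
    have := (curveS_le_curveRT_iff (Set.Ioo_subset_Icc_self hl)).not.1 (hw₀.trans hw₁).not_ge
    exact ⟨⟨not_le.1 this, hl.2⟩, hw₀, hw₁⟩

theorem mem_cellODF : x ∈ cellODF ↔ x ∈ openSquare ∧ curveS x.1 < x.2 ∧ x.2 < curveRT x.1 := by
  constructor
  · rintro ⟨⟨hl₀, hl₁⟩, hw₀, hw₁⟩
    have hl : x.1 ∈ Set.Ioo 0 1 := ⟨hl₀, by linarith⟩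
    exact ⟨⟨hl, (curveS_pos_of_mem hl).trans hw₀,
      hw₁.trans (curveRT_lt_one (Set.Ioo_subset_Icc_self hl))⟩, hw₀, hw₁⟩
  · rintro ⟨⟨hl, -⟩, hw₀, hw₁⟩
    have := (curveRT_le_curveS_iff (Set.Ioo_subset_Icc_self hl)).not.1 (hw₀.trans hw₁).not_ge
    exact ⟨⟨hl.1, not_le.1 this⟩, hw₀, hw₁⟩

theorem mem_cellDEF : x ∈ cellDEF ↔
    x ∈ openSquare ∧ curveS x.1 < x.2 ∧ curveRT x.1 < x.2 ∧ x.2 < curveR x.1 := by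
  constructor
  · rintro ⟨hl, hw₀, hw₁⟩
    rw [max_lt_iff] at hw₀
    exact ⟨⟨hl, (curveRT_pos_of_mem hl).trans hw₀.2, hw₁.trans curveR_lt_one⟩, hw₀.1, hw₀.2, hw₁⟩
  · rintro ⟨⟨hl, -⟩, hS, hRT, hw₁⟩
    exact ⟨hl, max_lt hS hRT, hw₁⟩

theorem mem_cellBDE : x ∈ cellBDE ↔ x ∈ openSquare ∧ curveR x.1 < x.2 := by
  constructor
  · rintro ⟨hl, hw₀, hw₁⟩
    exact ⟨⟨hl, curveR_nonneg.trans_lt hw₀, hw₁⟩, hw₀⟩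
  · rintro ⟨⟨hl, hw⟩, hw₀⟩
    exact ⟨hl, hw₀, hw.2⟩

end Cells

section Triangles

variable {T UV VW WU : Set (ℝ × ℝ)} {V W Z : ℝ × ℝ} {l : ℝ}

theorem curveS_lt_curveR_of_mem (hl : l ∈ Set.Ioo 0 1) : curveS l < curveR l :=
  curveS_lt_curveR (Set.Ioo_subset_Ico_self hl)

theorem curveRT_lt_curveR_of_mem (hl : l ∈ Set.Ioo 0 1) : curveRT l < curveR l :=
  curveRT_lt_curveR (Set.Ioo_subset_Ioc_self hl)

theorem IsCurvilinearTriangle.image_chart_of_below_curveR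
    (hT : IsCurvilinearTriangle T V W Z UV VW WU)
    (hTsub : ∀ x ∈ T, x ∈ openSquare ∧ x.2 < curveR x.1) :
    IsCurvilinearTriangle (chart '' T) (chart V) (chart W) (chart Z)
      (chart '' UV) (chart '' VW) (chart '' WU) := by
  refine hT.image_chart (fun x hx => (hTsub x hx).1) ?_
  have hpos (l : ℝ) : (0 : ℝ → ℝ) l < curveR l := threshold_pos coeffR_pos
  calc frontier T ⊆ closure T := frontier_subset_closure
    _ ⊆ closure (regionBetween 0 curveR (Set.Ioo 0 1)) :=
      closure_mono fun x hx => ⟨(hTsub x hx).1.1, (hTsub x hx).1.2.1, (hTsub x hx).2⟩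
    _ = closedRegionBetween 0 curveR (Set.Icc 0 1) :=
      closure_regionBetween_Ioo continuousOn_const continuousOn_curveR zero_lt_one
        (fun l _ => hpos l) fun l _ => (hpos l).le
    _ ⊆ Set.Icc 0 1 ×ˢ Set.Ico 0 1 := fun _ hx => ⟨hx.1, hx.2.1, hx.2.2.trans_lt curveR_lt_one⟩

theorem isCurvilinearTriangle_OAF : IsCurvilinearTriangle (chart '' cellOAF) ptO ptA
    (chart pointF) (chart '' arcOA) (chart '' arcAF) (chart '' arcOF) := by
  rw [← chart_ptO, ← chart_ptA]
  refine IsCurvilinearTriangle.image_chart_of_below_curveR ?_ fun x hx => ?_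
  · have hAF : arcAF = (Set.Icc (1 / 2) 1).graphOn fun l => min (curveS l) (curveRT l) :=
      Set.graphOn_inj.2 fun l hl => (min_eq_right
        ((curveRT_le_curveS_iff ⟨by linarith [hl.1], hl.2⟩).2 hl.1)).symm
    have hOF : arcOF = (Set.Icc 0 (1 / 2)).graphOn fun l => min (curveS l) (curveRT l) :=
      Set.graphOn_inj.2 fun l hl => (min_eq_left
        ((curveS_le_curveRT_iff ⟨hl.1, by linarith [hl.2]⟩).2 hl.2)).symm
    have hF : pointF = (1 / 2, min (curveS (1 / 2)) (curveRT (1 / 2))) := by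
      rw [curveS_half, min_self, pointF]
    rw [hAF, hOF, hF]
    refine isCurvilinearTriangle_regionBetween_of_vertex_above (by norm_num) (by norm_num)
      continuousOn_const (ContinuousOn.inf continuousOn_curveS continuousOn_curveRT) ?_ ?_
      fun l hl => lt_min (curveS_pos_of_mem hl) (curveRT_pos_of_mem hl)
    · norm_num [curveS_zero, curveRT_zero]
    · norm_num [curveS_one, curveRT_one]
  · obtain ⟨hx', hS, -⟩ := mem_cellOAF.1 hx
    exact ⟨hx', hS.trans (curveS_lt_curveR_of_mem hx'.1)⟩

theorem isCurvilinearTriangle_AEF : IsCurvilinearTriangle (chart '' cellAEF) ptA ptE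
    (chart pointF) (chart '' arcAE) (chart '' arcFE) (chart '' arcAF) := by
  rw [← chart_ptA, ← chart_ptE]
  refine IsCurvilinearTriangle.image_chart_of_below_curveR ?_ fun x hx => ?_
  · have hT := isCurvilinearTriangle_regionBetween_of_eq_left (a := 1 / 2) (b := 1) (by norm_num)
      (continuousOn_curveRT.mono (Set.Icc_subset_Icc_left (by norm_num)))
      (continuousOn_curveS.mono (Set.Icc_subset_Icc_left (by norm_num))) curveS_half.symm
      fun _ => curveRT_lt_curveS
    rwa [curveRT_one, curveS_one, curveS_half] at hT
  · obtain ⟨hx', hS, -⟩ := mem_cellAEF.1 hx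
    exact ⟨hx', hS.trans (curveS_lt_curveR_of_mem hx'.1)⟩

theorem isCurvilinearTriangle_ODF : IsCurvilinearTriangle (chart '' cellODF) ptO ptD
    (chart pointF) (segment ℝ ptO ptD) (chart '' arcFD) (chart '' arcOF) := by
  rw [← chart_ptO, ← chart_ptD,
    ← image_chart_vertical_zero le_rfl (by norm_num) (by norm_num)]
  refine IsCurvilinearTriangle.image_chart_of_below_curveR ?_ fun x hx => ?_
  · have hT := isCurvilinearTriangle_regionBetween_of_eq_right (a := 0) (b := 1 / 2) (by norm_num)
      (continuousOn_curveS.mono (Set.Icc_subset_Icc_right (by norm_num)))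
      (continuousOn_curveRT.mono (Set.Icc_subset_Icc_right (by norm_num))) curveS_half
      fun _ => curveS_lt_curveRT
    rwa [curveRT_zero, curveS_zero] at hT
  · obtain ⟨hx', -, hRT⟩ := mem_cellODF.1 hx
    exact ⟨hx', hRT.trans (curveRT_lt_curveR_of_mem hx'.1)⟩

theorem isCurvilinearTriangle_DEF : IsCurvilinearTriangle (chart '' cellDEF) ptD ptE
    (chart pointF) (chart '' arcED) (chart '' arcFE) (chart '' arcFD) := by
  rw [← chart_ptD, ← chart_ptE]
  refine IsCurvilinearTriangle.image_chart_of_below_curveR ?_ fun x hx => ?_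
  · have hFE : arcFE = (Set.Icc (1 / 2) 1).graphOn fun l => max (curveS l) (curveRT l) :=
      Set.graphOn_inj.2 fun l hl => (max_eq_left
        ((curveRT_le_curveS_iff ⟨by linarith [hl.1], hl.2⟩).2 hl.1)).symm
    have hFD : arcFD = (Set.Icc 0 (1 / 2)).graphOn fun l => max (curveS l) (curveRT l) :=
      Set.graphOn_inj.2 fun l hl => (max_eq_right
        ((curveS_le_curveRT_iff ⟨hl.1, by linarith [hl.2]⟩).2 hl.2)).symm
    have hF : pointF = (1 / 2, max (curveS (1 / 2)) (curveRT (1 / 2))) := by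
      rw [curveS_half, max_self, pointF]
    rw [hFE, hFD, hF, ← curveR_zero]
    nth_rw 2 [curveR_zero]
    rw [← curveR_one]
    refine isCurvilinearTriangle_regionBetween_of_vertex_below (by norm_num) (by norm_num)
      (ContinuousOn.sup continuousOn_curveS continuousOn_curveRT) continuousOn_curveR ?_ ?_
      fun l hl => max_lt (curveS_lt_curveR_of_mem hl) (curveRT_lt_curveR_of_mem hl)
    · norm_num [curveS_zero, curveRT_zero, curveR_zero]
    · norm_num [curveS_one, curveRT_one, curveR_one]
  · obtain ⟨hx', -, -, hR⟩ := mem_cellDEF.1 hx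
    exact ⟨hx', hR⟩

theorem isCurvilinearTriangle_BDE : IsCurvilinearTriangle (chart '' cellBDE) ptB ptD ptE
    (segment ℝ ptB ptD) (chart '' arcED) (chart '' arcEB) := by
  have hT := isCurvilinearTriangle_image_chart_above_graph
    (fun _ _ => ⟨curveR_nonneg, curveR_lt_one⟩) continuousOn_curveR
  rwa [curveR_zero, curveR_one, image_chart_vertical_zero (by norm_num) (by norm_num) le_rfl,
    segment_symm, chart_ptB, chart_ptD, chart_ptE] at hT

theorem image_chart_arcAE_union_arcEB :
    chart '' arcAE ∪ chart '' arcEB = chart '' ({1} ×ˢ Set.Icc 0 1) := by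
  rw [← Set.image_union, arcAE, arcEB, ← Set.prod_union,
    Set.Icc_union_Icc_eq_Icc (by norm_num) (by norm_num)]

theorem isCurvilinearTriangle_region : IsCurvilinearTriangle region ptO ptA ptB
    (chart '' arcOA) (chart '' arcAE ∪ chart '' arcEB) (segment ℝ ptB ptO) := by
  have hT := (isCurvilinearTriangle_image_chart_above_graph (f := 0) (fun _ _ => by simp)
    continuousOn_const).rotate
  have hsquare : regionBetween 0 1 (Set.Ioo 0 1) = openSquare := rfl
  rwa [hsquare, image_chart_openSquare, Pi.zero_apply, Pi.zero_apply,
    image_chart_vertical_zero le_rfl zero_le_one le_rfl, segment_symm, chart_ptO, chart_ptA,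
    chart_ptB, ← image_chart_arcAE_union_arcEB] at hT

end Triangles

section PassportSets

variable {Q : ℝ × ℝ → Prop} {S : Set (ℝ × ℝ)} {L : List ℕ} {u x : ℝ × ℝ} {l : ℝ}

theorem image_chart_eq_setOf (hS : ∀ x, x ∈ S ↔ x ∈ openSquare ∧ Q (chart x)) :
    chart '' S = {u ∈ region | Q u} := by
  have hSsq : S = openSquare ∩ chart ⁻¹' {u | Q u} := Set.ext hS
  rw [hSsq, Set.image_inter_preimage, image_chart_openSquare]
  rfl

theorem isMorse_and_passport_eq_iff (hu : u ∈ region) (hL : IsGreatest {n | n ∈ L} 4) :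
    IsMorse (p u) ∧ passport (p u) = L ↔ passport (p u) = L := by
  obtain ⟨r, s, t, hrst⟩ := mem_region_iff.1 hu
  rw [hrst.isMorse_iff]
  exact and_iff_right_of_imp fun h => h ▸ hL

theorem isDegenerateSnake_and_passport_eq_iff (hu : u ∈ region) (hL : IsGreatest {n | n ∈ L} 3) :
    IsDegenerateSnake (p u) ∧ passport (p u) = L ↔ passport (p u) = L := by
  obtain ⟨r, s, t, hrst⟩ := mem_region_iff.1 hu
  rw [hrst.isDegenerateSnake_iff]
  exact and_iff_right_of_imp fun h => h ▸ hL

theorem image_chart_eq_setOf_isMorse (hL : IsGreatest {n | n ∈ L} 4)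
    (hS : ∀ x, x ∈ S ↔ x ∈ openSquare ∧ passport (p (chart x)) = L) :
    chart '' S = {u ∈ region | IsMorse (p u) ∧ passport (p u) = L} :=
  image_chart_eq_setOf fun x => (hS x).trans <| and_congr_right fun hx =>
    (isMorse_and_passport_eq_iff (image_chart_openSquare ▸ Set.mem_image_of_mem chart hx) hL).symm

theorem image_chart_eq_setOf_isDegenerateSnake (hL : IsGreatest {n | n ∈ L} 3)
    (hS : ∀ x, x ∈ S ↔ x ∈ openSquare ∧ passport (p (chart x)) = L) :
    chart '' S = {u ∈ region | IsDegenerateSnake (p u) ∧ passport (p u) = L} :=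
  image_chart_eq_setOf fun x => (hS x).trans <| and_congr_right fun hx =>
    (isDegenerateSnake_and_passport_eq_iff
      (image_chart_openSquare ▸ Set.mem_image_of_mem chart hx) hL).symm

theorem image_chart_cellOAF :
    chart '' cellOAF = {u ∈ region | IsMorse (p u) ∧ passport (p u) = [4, 2, 3, 1]} := by
  refine image_chart_eq_setOf_isMorse (by simp [IsGreatest, upperBounds]) fun x =>
    mem_cellOAF.trans <| and_congr_right fun hx => ?_
  have := passport_chart_cases hx
  grind (splits := 20) [curveS_lt_curveR_of_mem hx.1, curveRT_lt_curveR_of_mem hx.1]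

theorem image_chart_cellAEF :
    chart '' cellAEF = {u ∈ region | IsMorse (p u) ∧ passport (p u) = [3, 2, 4, 1]} := by
  refine image_chart_eq_setOf_isMorse (by simp [IsGreatest, upperBounds]) fun x =>
    mem_cellAEF.trans <| and_congr_right fun hx => ?_
  have := passport_chart_cases hx
  grind (splits := 20) [curveS_lt_curveR_of_mem hx.1, curveRT_lt_curveR_of_mem hx.1]

theorem image_chart_cellODF :
    chart '' cellODF = {u ∈ region | IsMorse (p u) ∧ passport (p u) = [4, 1, 3, 2]} := by
  refine image_chart_eq_setOf_isMorse (by simp [IsGreatest, upperBounds]) fun x =>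
    mem_cellODF.trans <| and_congr_right fun hx => ?_
  have := passport_chart_cases hx
  grind (splits := 20) [curveS_lt_curveR_of_mem hx.1, curveRT_lt_curveR_of_mem hx.1]

theorem image_chart_cellDEF :
    chart '' cellDEF = {u ∈ region | IsMorse (p u) ∧ passport (p u) = [3, 1, 4, 2]} := by
  refine image_chart_eq_setOf_isMorse (by simp [IsGreatest, upperBounds]) fun x =>
    mem_cellDEF.trans <| and_congr_right fun hx => ?_
  have := passport_chart_cases hx
  grind (splits := 20) [curveS_lt_curveR_of_mem hx.1, curveRT_lt_curveR_of_mem hx.1]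

theorem image_chart_cellBDE :
    chart '' cellBDE = {u ∈ region | IsMorse (p u) ∧ passport (p u) = [2, 1, 4, 3]} := by
  refine image_chart_eq_setOf_isMorse (by simp [IsGreatest, upperBounds]) fun x =>
    mem_cellBDE.trans <| and_congr_right fun hx => ?_
  have := passport_chart_cases hx
  grind (splits := 20) [curveS_lt_curveR_of_mem hx.1, curveRT_lt_curveR_of_mem hx.1]

theorem image_chart_graphOn_Icc_diff {a b : ℝ} {f : ℝ → ℝ} (ha : 0 ≤ a) (hab : a ≤ b) (hb : b ≤ 1)
    (hf : ∀ l ∈ Set.Icc 0 1, f l ∈ Set.Ico 0 1) :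
    chart '' (Set.Icc a b).graphOn f \ {chart (a, f a), chart (b, f b)} =
      chart '' (Set.Ioo a b).graphOn f := by
  have hinj : Set.InjOn (fun l => chart (l, f l)) (Set.Icc a b) := fun l hl m hm hlm =>
    congrArg Prod.fst (injOn_chart (graphOn_subset hf ⟨l, Set.Icc_subset_Icc ha hb hl, rfl⟩)
      (graphOn_subset hf ⟨m, Set.Icc_subset_Icc ha hb hm, rfl⟩) hlm)
  have hends : {a, b} ⊆ Set.Icc a b :=
    Set.pair_subset (Set.left_mem_Icc.2 hab) (Set.right_mem_Icc.2 hab)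
  rw [Set.graphOn, Set.graphOn, Set.image_image, Set.image_image, ← Set.Icc_sdiff_both,
    hinj.image_sdiff_subset hends, Set.image_pair]

theorem mem_graphOn_curveRT : x ∈ (Set.Ioo 0 1).graphOn curveRT ↔
    x ∈ openSquare ∧ curveRT x.1 = x.2 := by
  rw [Set.mem_graphOn]
  refine ⟨fun ⟨hl, hw⟩ => ⟨⟨hl, hw ▸ ?_⟩, hw⟩, fun ⟨hx, hw⟩ => ⟨hx.1, hw⟩⟩
  exact ⟨curveRT_pos_of_mem hl, curveRT_lt_one (Set.Ioo_subset_Icc_self hl)⟩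

theorem mem_graphOn_curveS : x ∈ (Set.Ioo 0 1).graphOn curveS ↔
    x ∈ openSquare ∧ curveS x.1 = x.2 := by
  rw [Set.mem_graphOn]
  refine ⟨fun ⟨hl, hw⟩ => ⟨⟨hl, hw ▸ ?_⟩, hw⟩, fun ⟨hx, hw⟩ => ⟨hx.1, hw⟩⟩
  exact ⟨curveS_pos_of_mem hl, curveS_lt_one (Set.Ioo_subset_Icc_self hl)⟩

theorem mem_graphOn_curveR : x ∈ (Set.Ioo 0 1).graphOn curveR ↔
    x ∈ openSquare ∧ curveR x.1 = x.2 := by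
  rw [Set.mem_graphOn]
  refine ⟨fun ⟨hl, hw⟩ => ⟨⟨hl, hw ▸ ?_⟩, hw⟩, fun ⟨hx, hw⟩ => ⟨hx.1, hw⟩⟩
  exact ⟨(curveRT_pos_of_mem hl).trans (curveRT_lt_curveR_of_mem hl), curveR_lt_one⟩

theorem mem_graphOn_Ioo_half_one {f : ℝ → ℝ} : x ∈ (Set.Ioo (1 / 2) 1).graphOn f ↔
    x ∈ (Set.Ioo 0 1).graphOn f ∧ curveRT x.1 < curveS x.1 := by
  rw [Set.mem_graphOn, Set.mem_graphOn]
  constructor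
  · rintro ⟨⟨hl₀, hl₁⟩, hw⟩
    exact ⟨⟨⟨by linarith, hl₁⟩, hw⟩, curveRT_lt_curveS ⟨hl₀, hl₁.le⟩⟩
  · rintro ⟨⟨hl, hw⟩, hlt⟩
    have := (curveS_le_curveRT_iff (Set.Ioo_subset_Icc_self hl)).not.1 hlt.not_ge
    exact ⟨⟨not_le.1 this, hl.2⟩, hw⟩

theorem mem_graphOn_Ioo_zero_half {f : ℝ → ℝ} : x ∈ (Set.Ioo 0 (1 / 2)).graphOn f ↔
    x ∈ (Set.Ioo 0 1).graphOn f ∧ curveS x.1 < curveRT x.1 := by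
  rw [Set.mem_graphOn, Set.mem_graphOn]
  constructor
  · rintro ⟨⟨hl₀, hl₁⟩, hw⟩
    exact ⟨⟨⟨hl₀, by linarith⟩, hw⟩, curveS_lt_curveRT ⟨hl₀.le, hl₁⟩⟩
  · rintro ⟨⟨hl, hw⟩, hlt⟩
    have := (curveRT_le_curveS_iff (Set.Ioo_subset_Icc_self hl)).not.1 hlt.not_ge
    exact ⟨⟨hl.1, not_le.1 this⟩, hw⟩

theorem curveRT_mem_Ico (hl : l ∈ Set.Icc 0 1) : curveRT l ∈ Set.Ico 0 1 :=
  ⟨curveRT_nonneg hl, curveRT_lt_one hl⟩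

theorem curveS_mem_Ico (hl : l ∈ Set.Icc 0 1) : curveS l ∈ Set.Ico 0 1 :=
  ⟨curveS_nonneg hl, curveS_lt_one hl⟩

theorem curveR_mem_Ico : curveR l ∈ Set.Ico 0 1 :=
  ⟨curveR_nonneg, curveR_lt_one⟩

theorem image_chart_arcAF_diff : chart '' arcAF \ {ptA, chart pointF} =
    {u ∈ region | IsDegenerateSnake (p u) ∧ passport (p u) = [3, 2, 3, 1]} := by
  have hdiff := image_chart_graphOn_Icc_diff (f := curveRT) (a := 1 / 2) (b := 1) (by norm_num)
    (by norm_num) (by norm_num) fun _ => curveRT_mem_Ico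
  rw [curveRT_one, chart_ptA, Set.pair_comm] at hdiff
  refine hdiff.trans <|
    image_chart_eq_setOf_isDegenerateSnake (by simp [IsGreatest, upperBounds]) fun x => ?_
  rw [mem_graphOn_Ioo_half_one, mem_graphOn_curveRT, and_assoc]
  refine and_congr_right fun hx => ?_
  have := passport_chart_cases hx
  grind (splits := 20) [curveS_lt_curveR_of_mem hx.1, curveRT_lt_curveR_of_mem hx.1]

theorem image_chart_arcOF_diff : chart '' arcOF \ {ptO, chart pointF} =
    {u ∈ region | IsDegenerateSnake (p u) ∧ passport (p u) = [3, 1, 2, 1]} := by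
  have hdiff := image_chart_graphOn_Icc_diff (f := curveS) (a := 0) (b := 1 / 2) (by norm_num)
    (by norm_num) (by norm_num) fun _ => curveS_mem_Ico
  rw [curveS_zero, chart_ptO, curveS_half] at hdiff
  refine hdiff.trans <|
    image_chart_eq_setOf_isDegenerateSnake (by simp [IsGreatest, upperBounds]) fun x => ?_
  rw [mem_graphOn_Ioo_zero_half, mem_graphOn_curveS, and_assoc]
  refine and_congr_right fun hx => ?_
  have := passport_chart_cases hx
  grind (splits := 20) [curveS_lt_curveR_of_mem hx.1, curveRT_lt_curveR_of_mem hx.1]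

theorem image_chart_arcFD_diff : chart '' arcFD \ {chart pointF, ptD} =
    {u ∈ region | IsDegenerateSnake (p u) ∧ passport (p u) = [3, 1, 3, 2]} := by
  have hdiff := image_chart_graphOn_Icc_diff (f := curveRT) (a := 0) (b := 1 / 2) (by norm_num)
    (by norm_num) (by norm_num) fun _ => curveRT_mem_Ico
  rw [curveRT_zero, chart_ptD, Set.pair_comm] at hdiff
  refine hdiff.trans <|
    image_chart_eq_setOf_isDegenerateSnake (by simp [IsGreatest, upperBounds]) fun x => ?_
  rw [mem_graphOn_Ioo_zero_half, mem_graphOn_curveRT, and_assoc]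
  refine and_congr_right fun hx => ?_
  have := passport_chart_cases hx
  grind (splits := 20) [curveS_lt_curveR_of_mem hx.1, curveRT_lt_curveR_of_mem hx.1]

theorem image_chart_arcFE_diff : chart '' arcFE \ {chart pointF, ptE} =
    {u ∈ region | IsDegenerateSnake (p u) ∧ passport (p u) = [2, 1, 3, 1]} := by
  have hdiff := image_chart_graphOn_Icc_diff (f := curveS) (a := 1 / 2) (b := 1) (by norm_num)
    (by norm_num) (by norm_num) fun _ => curveS_mem_Ico
  rw [curveS_one, chart_ptE, curveS_half] at hdiff
  refine hdiff.trans <|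
    image_chart_eq_setOf_isDegenerateSnake (by simp [IsGreatest, upperBounds]) fun x => ?_
  rw [mem_graphOn_Ioo_half_one, mem_graphOn_curveS, and_assoc]
  refine and_congr_right fun hx => ?_
  have := passport_chart_cases hx
  grind (splits := 20) [curveS_lt_curveR_of_mem hx.1, curveRT_lt_curveR_of_mem hx.1]

theorem image_chart_arcED_diff : chart '' arcED \ {ptE, ptD} =
    {u ∈ region | IsDegenerateSnake (p u) ∧ passport (p u) = [2, 1, 3, 2]} := by
  have hdiff := image_chart_graphOn_Icc_diff (f := curveR) (a := 0) (b := 1) (by norm_num)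
    (by norm_num) (by norm_num) fun _ _ => curveR_mem_Ico
  rw [curveR_zero, curveR_one, chart_ptD, chart_ptE, Set.pair_comm] at hdiff
  refine hdiff.trans <|
    image_chart_eq_setOf_isDegenerateSnake (by simp [IsGreatest, upperBounds]) fun x => ?_
  rw [mem_graphOn_curveR]
  refine and_congr_right fun hx => ?_
  have := passport_chart_cases hx
  grind (splits := 20) [curveS_lt_curveR_of_mem hx.1, curveRT_lt_curveR_of_mem hx.1]

end PassportSets

section CurveSets

variable {x : ℝ × ℝ}

theorem g_chart_eq_zero_iff (hx : x ∈ openSquare) : g (chart x) = 0 ↔ curveRT x.1 = x.2 :=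
  (g_eq_zero_iff_eval ((hasOrderedCriticalPoints_chart_iff
    (openSquare_subset_closedSquare hx)).2 hx)).trans
    (eq_iff_eq_of_cmp_eq_cmp (cmp_eval_chartR_chartT hx))

theorem h_chart_eq_zero_iff (hx : x ∈ openSquare) :
    h (chart x) = 0 ↔ curveR x.1 = x.2 ∨ curveS x.1 = x.2 :=
  (h_eq_zero_iff_eval ((hasOrderedCriticalPoints_chart_iff
    (openSquare_subset_closedSquare hx)).2 hx)).trans
    (or_congr (eq_iff_eq_of_cmp_eq_cmp (cmp_eval_chartR_zero hx))
      (eq_iff_eq_of_cmp_eq_cmp (cmp_eval_chartS_zero hx)))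

theorem setOf_g_eq_zero_and_h_eq_zero : {u ∈ region | g u = 0 ∧ h u = 0} = {chart pointF} := by
  rw [← Set.image_singleton]
  refine (image_chart_eq_setOf fun x => ⟨?_, ?_⟩).symm
  · rintro rfl
    have hF : pointF ∈ openSquare :=
      (mem_graphOn_curveRT.1 (Set.mem_graphOn.2 ⟨by norm_num [pointF], rfl⟩)).1
    exact ⟨hF, (g_chart_eq_zero_iff hF).2 rfl, (h_chart_eq_zero_iff hF).2 (Or.inr curveS_half)⟩
  · rintro ⟨hx, hg, hh⟩
    have hRT := (g_chart_eq_zero_iff hx).1 hg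
    have hS : curveS x.1 = x.2 := ((h_chart_eq_zero_iff hx).1 hh).resolve_left fun hR =>
      (curveRT_lt_curveR_of_mem hx.1).ne (hRT.trans hR.symm)
    have hl := Set.Ioo_subset_Icc_self hx.1
    have hx₁ : x.1 = 1 / 2 := le_antisymm
      ((curveS_le_curveRT_iff hl).1 (hS.trans hRT.symm).le)
      ((curveRT_le_curveS_iff hl).1 (hRT.trans hS.symm).le)
    exact Prod.ext hx₁ (hRT.symm.trans (congrArg curveRT hx₁))

theorem graphOn_Icc_half_union (f : ℝ → ℝ) :
    (Set.Icc 0 (1 / 2)).graphOn f ∪ (Set.Icc (1 / 2) 1).graphOn f = (Set.Icc 0 1).graphOn f := by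
  rw [Set.graphOn, Set.graphOn, ← Set.image_union,
    Set.Icc_union_Icc_eq_Icc (by norm_num) (by norm_num)]
  rfl

theorem setOf_g_eq_zero :
    {u ∈ region | g u = 0} = (chart '' arcAF ∪ chart '' arcFD) \ {ptA, ptD} := by
  have hdiff := image_chart_graphOn_Icc_diff (f := curveRT) le_rfl zero_le_one le_rfl
    fun _ => curveRT_mem_Ico
  rw [curveRT_zero, curveRT_one, chart_ptA, chart_ptD, Set.pair_comm,
    ← graphOn_Icc_half_union, Set.union_comm, Set.image_union] at hdiff
  refine (hdiff.trans (image_chart_eq_setOf fun x => ?_)).symm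
  rw [mem_graphOn_curveRT]
  exact and_congr_right fun hx => (g_chart_eq_zero_iff hx).symm

theorem setOf_h_eq_zero : {u ∈ region | h u = 0} =
    (chart '' arcOF ∪ chart '' arcFE ∪ chart '' arcED) \ {ptO, ptE, ptD} := by
  have hS := graphOn_subset fun _ => curveS_mem_Ico
  have hR := graphOn_subset (f := curveR) fun _ _ => curveR_mem_Ico
  have hends : {(0, 0), (1, 3 / 5), (0, 3 / 5)} ⊆ Set.Icc (0 : ℝ) 1 ×ˢ Set.Ico (0 : ℝ) 1 := by
    rintro _ (rfl | rfl | rfl) <;> norm_num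
  have hdiff := image_diff_of_injective_at (Φ := chart) fun x hx y hy =>
    injOn_chart (Set.union_subset hS hR hx) (hends hy)
  rw [Set.image_insert_eq, Set.image_pair, chart_ptO, chart_ptE, chart_ptD,
    ← graphOn_Icc_half_union, Set.image_union, Set.image_union] at hdiff
  refine (hdiff.symm.trans (image_chart_eq_setOf fun x => ?_)).symm
  rw [graphOn_Icc_half_union]
  constructor
  · rintro ⟨hx, hends⟩
    simp only [Set.mem_insert_iff, Set.mem_singleton_iff, Prod.ext_iff, not_or] at hends
    have hne : x.1 ≠ 0 ∧ x.1 ≠ 1 := by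
      rw [Set.mem_union, Set.mem_graphOn, Set.mem_graphOn] at hx
      grind [curveS_zero, curveS_one, curveR_zero, curveR_one]
    rcases hx with ⟨l, hl, rfl⟩ | ⟨l, hl, rfl⟩
    · have hl' : l ∈ Set.Ioo (0 : ℝ) 1 := ⟨hl.1.lt_of_ne' hne.1, hl.2.lt_of_ne hne.2⟩
      have hx := (mem_graphOn_curveS.1 ⟨l, hl', rfl⟩).1
      exact ⟨hx, (h_chart_eq_zero_iff hx).2 (Or.inr rfl)⟩
    · have hl' : l ∈ Set.Ioo (0 : ℝ) 1 := ⟨hl.1.lt_of_ne' hne.1, hl.2.lt_of_ne hne.2⟩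
      have hx := (mem_graphOn_curveR.1 ⟨l, hl', rfl⟩).1
      exact ⟨hx, (h_chart_eq_zero_iff hx).2 (Or.inl rfl)⟩
  · rintro ⟨hx, hh⟩
    have hl := Set.Ioo_subset_Icc_self hx.1
    refine ⟨((h_chart_eq_zero_iff hx).1 hh).symm.imp (fun hS => Set.mem_graphOn.2 ⟨hl, hS⟩)
      fun hR => Set.mem_graphOn.2 ⟨hl, hR⟩, ?_⟩
    rintro (rfl | rfl | rfl)
    exacts [hx.1.1.false, hx.1.2.false, hx.1.1.false]

theorem setOf_g_ne_zero_and_h_ne_zero : {u ∈ region | g u ≠ 0 ∧ h u ≠ 0} =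
    chart '' cellOAF ∪ chart '' cellAEF ∪ chart '' cellODF ∪ chart '' cellDEF ∪
      chart '' cellBDE := by
  simp only [← Set.image_union]
  refine (image_chart_eq_setOf fun x => ?_).symm
  simp only [Set.mem_union, mem_cellOAF, mem_cellAEF, mem_cellODF, mem_cellDEF, mem_cellBDE,
    ← and_or_left]
  refine and_congr_right fun hx => ?_
  rw [ne_eq, ne_eq, g_chart_eq_zero_iff hx, h_chart_eq_zero_iff hx]
  grind (splits := 20) [curveS_lt_curveR_of_mem hx.1, curveRT_lt_curveR_of_mem hx.1]

theorem pairwise_disjoint_cells : [chart '' cellOAF, chart '' cellAEF, chart '' cellODF,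
    chart '' cellDEF, chart '' cellBDE].Pairwise Disjoint := by
  have hdisj (L M : List ℕ) (hLM : L ≠ M) :
      Disjoint {u ∈ region | IsMorse (p u) ∧ passport (p u) = L}
        {u ∈ region | IsMorse (p u) ∧ passport (p u) = M} :=
    Set.disjoint_left.2 fun _ hL hM => hLM (hL.2.2.symm.trans hM.2.2)
  have hne : [[4, 2, 3, 1], [3, 2, 4, 1], [4, 1, 3, 2], [3, 1, 4, 2], [2, 1, 4, 3]].Pairwise
      (fun L M : List ℕ => L ≠ M) := by decide
  rw [image_chart_cellOAF, image_chart_cellAEF, image_chart_cellODF, image_chart_cellDEF,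
    image_chart_cellBDE]
  exact hne.map (fun L => {u ∈ region | IsMorse (p u) ∧ passport (p u) = L}) hdisj

theorem chart_pointF : chart pointF =
    (9 / 4 + 9 / 16 * (1 - curveRT (1 / 2) ^ 2), 27 / 32 * (1 - curveRT (1 / 2) ^ 2)) := by
  have hscale : chartScale (1 / 2, curveRT (1 / 2)) = 3 / 2 := by
    rw [chartScale]
    norm_num
  simp only [pointF, chart, chartR, chartS, chartT, hscale]
  ext <;> ring

theorem curveRT_half : curveRT (1 / 2) = (√20 - 2) / (√20 + 2) := by
  have hsq : (1 - 6 * (1 / 2) : ℝ) ^ 2 + 8 * ((1 - 1 / 2) * (3 + 2 * (1 / 2))) = √20 ^ 2 := by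
    norm_num
  rw [curveRT, threshold_of_sq_eq (Real.sqrt_nonneg 20) hsq]
  congr 1 <;> ring

theorem abs_chart_pointF_sub_lt :
    |(chart pointF).1 - 2.73| < 0.005 ∧ |(chart pointF).2 - 0.72| < 0.005 := by
  have h₁ : 4.47 < √20 := Real.lt_sqrt_of_sq_lt (by norm_num)
  have h₂ : √20 < 4.48 := (Real.sqrt_lt' (by norm_num)).2 (by norm_num)
  have hw₁ : 0.38 < curveRT (1 / 2) := by
    rw [curveRT_half, lt_div_iff₀ (by positivity)]
    linarith
  have hw₂ : curveRT (1 / 2) < 0.383 := by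
    rw [curveRT_half, div_lt_iff₀ (by positivity)]
    linarith
  have hsq₁ : 0.38 ^ 2 < curveRT (1 / 2) ^ 2 := by gcongr
  have hsq₂ : curveRT (1 / 2) ^ 2 < 0.383 ^ 2 := by gcongr
  rw [chart_pointF, abs_lt, abs_lt]
  norm_num at *
  refine ⟨⟨?_, ?_⟩, ?_, ?_⟩ <;> linarith

theorem image_chart_closedSquare :
    chart '' closedSquare = {u | 0 ≤ u.1 ∧ 0 ≤ u.2 ∧ 0 ≤ dq u} := by
  ext u
  constructor
  · rintro ⟨x, hx, rfl⟩
    have hT : chartT x ≤ 0 := neg_nonneg.1 (neg_chartT (x := x) ▸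
      mul_nonneg (chartScale_pos hx).le (mul_nonneg hx.1.1 (sub_nonneg.2 hx.2.2)))
    have hS := (chartS_le_chartT hx).trans hT
    have hR := (chartR_le_chartS hx).trans hS
    refine ⟨?_, neg_nonneg.2 (mul_nonpos_of_nonneg_of_nonpos (mul_nonneg_of_nonpos_of_nonpos
      hR hS) hT), (hasRoots_chart hx).dq_eq ▸ sq_nonneg _⟩
    exact add_nonneg (add_nonneg (mul_nonneg_of_nonpos_of_nonpos hR hS)
      (mul_nonneg_of_nonpos_of_nonpos hR hT)) (mul_nonneg_of_nonpos_of_nonpos hS hT)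
  · rintro ⟨hb, hc, hd⟩
    obtain ⟨r, s, t, hrs, hst, ht, hu⟩ := exists_sorted_hasRoots hb hc hd
    obtain ⟨x, hx, hxu, -⟩ := exists_chart_eq hrs hst ht hu
    exact ⟨x, hx, hxu⟩

theorem dq_chart_eq_zero_iff (hx : x ∈ closedSquare) :
    dq (chart x) = 0 ↔ x.2 = 0 ∨ x.1 = 1 ∨ x.2 = 1 := by
  have hk := (chartScale_pos hx).ne'
  have hRT : chartT x - chartR x = chartScale x * (x.2 + (1 - x.1) * (1 - x.2)) := by
    rw [← sub_add_sub_cancel _ (chartS x), chartT_sub_chartS, chartS_sub_chartR, mul_add]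
  rw [(hasRoots_chart hx).dq_eq, sq_eq_zero_iff, chartS_sub_chartR, chartT_sub_chartS, hRT]
  have hsum : x.2 + (1 - x.1) * (1 - x.2) = 0 → x.2 = 0 := fun h => by
    linarith [hx.2.1, mul_nonneg (sub_nonneg.2 hx.1.2) (sub_nonneg.2 hx.2.2)]
  simp only [mul_eq_zero, hk, false_or, sub_eq_zero]
  grind

theorem setOf_dq_eq_zero : {u | 0 ≤ u.1 ∧ 0 ≤ u.2 ∧ dq u = 0} =
    chart '' arcOA ∪ chart '' arcAE ∪ chart '' arcEB := by
  have hsetOf : {u | 0 ≤ u.1 ∧ 0 ≤ u.2 ∧ dq u = 0} =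
      chart '' (closedSquare ∩ chart ⁻¹' {u | dq u = 0}) := by
    rw [Set.image_inter_preimage, image_chart_closedSquare]
    ext u
    exact ⟨fun ⟨hb, hc, hd⟩ => ⟨⟨hb, hc, hd.ge⟩, hd⟩, fun ⟨⟨hb, hc, _⟩, hd⟩ => ⟨hb, hc, hd⟩⟩
  rw [hsetOf, Set.union_assoc, image_chart_arcAE_union_arcEB]
  ext u
  constructor
  · rintro ⟨x, ⟨hx, hd⟩, rfl⟩
    rcases (dq_chart_eq_zero_iff hx).1 hd with hw | hl | hw
    · exact Or.inl ⟨x, ⟨x.1, hx.1, Prod.ext rfl hw.symm⟩, rfl⟩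
    · exact Or.inr ⟨x, ⟨hl, hx.2⟩, rfl⟩
    · exact Or.inr ⟨(1, 1), ⟨rfl, by simp⟩,
        (chart_ptB 1).trans ((chart_ptB x.1).symm.trans (by rw [← hw]))⟩
  · rintro (⟨_, ⟨l, hl, rfl⟩, rfl⟩ | ⟨x, ⟨hl, hw⟩, rfl⟩)
    · have hx : (l, 0) ∈ closedSquare := ⟨hl, by simp⟩
      exact ⟨(l, 0), ⟨hx, (dq_chart_eq_zero_iff hx).2 (Or.inl rfl)⟩, rfl⟩
    · have hl : x.1 = 1 := hl
      have hx : x ∈ closedSquare := ⟨by simp [hl], hw⟩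
      exact ⟨x, ⟨hx, (dq_chart_eq_zero_iff hx).2 (Or.inr (Or.inl hl))⟩, rfl⟩

end CurveSets

section Passports

variable {P : ℝ[X]} {L : List ℕ} {Y Z : ℝ × ℝ} {γ T : Set (ℝ × ℝ)}

theorem exists_passport_chart_eq {x₁ x₂ x₃ x₄ : ℝ} (hP : HasOrderedCriticalPoints P x₁ x₂ x₃ x₄) :
    ∃ x ∈ openSquare, passport (p (chart x)) = passport P := by
  obtain ⟨u, hu, hpass, -⟩ := exists_comp_eq_p hP
  rw [← image_chart_openSquare] at hu
  obtain ⟨x, hx, rfl⟩ := hu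
  exact ⟨x, hx, hpass⟩

theorem passport_mem_of_isMorse (h5 : P.natDegree = 5) (hP : IsMorse P) : passport P ∈
    ({[4, 2, 3, 1], [3, 2, 4, 1], [4, 1, 3, 2], [3, 1, 4, 2], [2, 1, 4, 3]} : Set (List ℕ)) := by
  obtain ⟨x₁, x₂, x₃, x₄, hcrit⟩ := exists_hasOrderedCriticalPoints_of_isMorse h5 hP
  obtain ⟨x, hx, hpass⟩ := exists_passport_chart_eq hcrit
  have hmax : 4 ∈ passport P := (hcrit.isMorse_iff.1 hP).1
  rw [← hpass] at hmax ⊢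
  rcases passport_chart_cases hx with ⟨-, -, h⟩ | ⟨-, -, h⟩ | ⟨-, -, h⟩ | ⟨-, -, h⟩ | ⟨-, -, h⟩ |
    ⟨-, -, h⟩ | ⟨-, -, h⟩ | ⟨-, -, h⟩ | ⟨-, -, -, h⟩ | ⟨-, h⟩ | ⟨-, h⟩ <;>
    rw [h] at hmax ⊢ <;> simp at hmax ⊢

theorem passport_mem_of_isDegenerateSnake (hP : IsDegenerateSnake P) : passport P ∈
    ({[3, 1, 3, 2], [3, 2, 3, 1], [3, 1, 2, 1], [2, 1, 3, 1], [2, 1, 3, 2]} : Set (List ℕ)) := by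
  obtain ⟨x₁, x₂, x₃, x₄, hcrit⟩ := exists_hasOrderedCriticalPoints hP.1 hP.2.1 hP.2.2.1
  obtain ⟨x, hx, hpass⟩ := exists_passport_chart_eq hcrit
  obtain ⟨hmem, hmax⟩ := hcrit.isDegenerateSnake_iff.1 hP
  have hfour : 4 ∉ passport P := fun h => absurd (hmax h) (by norm_num)
  change 3 ∈ passport P at hmem
  rw [← hpass] at hmem hfour ⊢
  rcases passport_chart_cases hx with ⟨-, -, h⟩ | ⟨-, -, h⟩ | ⟨-, -, h⟩ | ⟨-, -, h⟩ | ⟨-, -, h⟩ |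
    ⟨-, -, h⟩ | ⟨-, -, h⟩ | ⟨-, -, h⟩ | ⟨-, -, -, h⟩ | ⟨-, h⟩ | ⟨-, h⟩ <;>
    rw [h] at hmem hfour ⊢ <;> simp at hmem hfour ⊢

theorem IsSimpleArc.nonempty_diff (hγ : IsSimpleArc γ Y Z) : (γ \ {Y, Z}).Nonempty := by
  obtain ⟨f, hf, rfl⟩ := hγ
  obtain ⟨t, ht₀, ht₁⟩ := exists_between (zero_lt_one : (0 : unitInterval) < 1)
  refine ⟨f t, ⟨t, rfl⟩, ?_⟩
  rintro (h | h)
  · exact ht₀.ne' (hf (h.trans f.source.symm))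
  · exact ht₁.ne (hf (Eq.trans h f.target.symm))

theorem exists_isMorse_passport_eq (hT : IsConnected T)
    (h : T = {u ∈ region | IsMorse (p u) ∧ passport (p u) = L}) :
    ∃ P : ℝ[X], P.natDegree = 5 ∧ IsMorse P ∧ passport P = L := by
  obtain ⟨u, hu⟩ := hT.nonempty
  rw [h] at hu
  exact ⟨p u, natDegree_p, hu.2⟩

theorem exists_isDegenerateSnake_passport_eq (hγ : IsSimpleArc γ Y Z)
    (h : γ \ {Y, Z} = {u ∈ region | IsDegenerateSnake (p u) ∧ passport (p u) = L}) :
    ∃ P : ℝ[X], IsDegenerateSnake P ∧ passport P = L := by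
  obtain ⟨u, hu⟩ := hγ.nonempty_diff
  rw [h] at hu
  exact ⟨p u, hu.2⟩

theorem setOf_passport_isMorse :
    {a | ∃ P : ℝ[X], P.natDegree = 5 ∧ IsMorse P ∧ passport P = a} =
      {[4, 2, 3, 1], [3, 2, 4, 1], [4, 1, 3, 2], [3, 1, 4, 2], [2, 1, 4, 3]} := by
  refine Set.Subset.antisymm (fun _ ⟨P, h5, hP, hpass⟩ => hpass ▸ passport_mem_of_isMorse h5 hP) ?_
  have hconn {T U V W UV VW WU} (hT : IsCurvilinearTriangle T U V W UV VW WU) : IsConnected T :=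
    hT.2.2.2.2.2.2.2.1
  rintro _ (rfl | rfl | rfl | rfl | rfl)
  · exact exists_isMorse_passport_eq (hconn isCurvilinearTriangle_OAF) image_chart_cellOAF
  · exact exists_isMorse_passport_eq (hconn isCurvilinearTriangle_AEF) image_chart_cellAEF
  · exact exists_isMorse_passport_eq (hconn isCurvilinearTriangle_ODF) image_chart_cellODF
  · exact exists_isMorse_passport_eq (hconn isCurvilinearTriangle_DEF) image_chart_cellDEF
  · exact exists_isMorse_passport_eq (hconn isCurvilinearTriangle_BDE) image_chart_cellBDE

theorem setOf_passport_isDegenerateSnake :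
    {a | ∃ P : ℝ[X], IsDegenerateSnake P ∧ passport P = a} =
      {[3, 1, 3, 2], [3, 2, 3, 1], [3, 1, 2, 1], [2, 1, 3, 1], [2, 1, 3, 2]} := by
  refine Set.Subset.antisymm
    (fun _ ⟨P, hP, hpass⟩ => hpass ▸ passport_mem_of_isDegenerateSnake hP) ?_
  obtain ⟨-, hAF, hFO, -⟩ := isCurvilinearTriangle_OAF
  obtain ⟨hDE, hEF, hFD, -⟩ := isCurvilinearTriangle_DEF
  rintro _ (rfl | rfl | rfl | rfl | rfl)
  · exact exists_isDegenerateSnake_passport_eq hFD image_chart_arcFD_diff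
  · exact exists_isDegenerateSnake_passport_eq hAF image_chart_arcAF_diff
  · exact exists_isDegenerateSnake_passport_eq hFO.symm image_chart_arcOF_diff
  · exact exists_isDegenerateSnake_passport_eq hEF.symm image_chart_arcFE_diff
  · exact exists_isDegenerateSnake_passport_eq hDE.symm image_chart_arcED_diff

end Passports

end MorseQuintic

open Polynomial MorseQuintic in
theorem mainTheorem1 :
    -- normalisation of a real Morse polynomial of degree 5
    (∀ P : ℝ[X], P.natDegree = 5 → IsMorse P →
      ∃ u ∈ region, ∃ k l m : ℝ, 0 < k ∧
        P.comp (C k * X + C l) = C (k ^ 5) * p u + C m ∧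
        IsMorse (p u) ∧ passport (p u) = passport P) ∧
    (∀ u : ℝ × ℝ, derivative (p u) = C 5 * (X * q u)) ∧
    -- the discriminant curve and the region it cuts out
    (∀ u : ℝ × ℝ, (q u).discr = dq u) ∧
    region = {u | 0 < u.1 ∧ 0 < u.2 ∧ 0 < dq u} ∧
    -- the meaning of the curves `g = 0` and `h = 0`
    (∀ u ∈ region, g u = 0 ↔
      ∃ x y : ℝ, x ≠ y ∧ (q u).IsRoot x ∧ (q u).IsRoot y ∧ (p u).eval x = (p u).eval y) ∧
    (∀ u ∈ region, h u = 0 ↔ ∃ x : ℝ, (q u).IsRoot x ∧ (p u).eval x = 0) ∧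
    (∀ u : ℝ × ℝ, 0 < u.1 → 0 < u.2 → (IsMorse (p u) ↔ u ∈ region ∧ g u ≠ 0 ∧ h u ≠ 0)) ∧
    -- the partition
    (∃ (F : ℝ × ℝ) (OA AE EB AF FD OF FE ED OAF AEF ODF DEF BDE : Set (ℝ × ℝ)),
      -- the point `F`
      {u ∈ region | g u = 0 ∧ h u = 0} = {F} ∧
      |F.1 - 2.73| < 0.005 ∧ |F.2 - 0.72| < 0.005 ∧
      -- the triangle `OAB`, with sides on `dq = 0` and on the axis `c = 0`
      IsCurvilinearTriangle region ptO ptA ptB OA (AE ∪ EB) (segment ℝ ptB ptO) ∧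
      {u | 0 ≤ u.1 ∧ 0 ≤ u.2 ∧ dq u = 0} = OA ∪ AE ∪ EB ∧
      -- the arcs cut out in it by `g = 0` and `h = 0`
      {u ∈ region | g u = 0} = (AF ∪ FD) \ {ptA, ptD} ∧
      {u ∈ region | h u = 0} = (OF ∪ FE ∪ ED) \ {ptO, ptE, ptD} ∧
      -- the five triangles
      IsCurvilinearTriangle OAF ptO ptA F OA AF OF ∧
      IsCurvilinearTriangle AEF ptA ptE F AE FE AF ∧
      IsCurvilinearTriangle ODF ptO ptD F (segment ℝ ptO ptD) FD OF ∧
      IsCurvilinearTriangle DEF ptD ptE F ED FE FD ∧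
      IsCurvilinearTriangle BDE ptB ptD ptE (segment ℝ ptB ptD) ED EB ∧
      [OAF, AEF, ODF, DEF, BDE].Pairwise Disjoint ∧
      {u ∈ region | g u ≠ 0 ∧ h u ≠ 0} = OAF ∪ AEF ∪ ODF ∪ DEF ∪ BDE ∧
      -- the snakes of the five triangles
      OAF = {u ∈ region | IsMorse (p u) ∧ passport (p u) = [4, 2, 3, 1]} ∧
      AEF = {u ∈ region | IsMorse (p u) ∧ passport (p u) = [3, 2, 4, 1]} ∧
      ODF = {u ∈ region | IsMorse (p u) ∧ passport (p u) = [4, 1, 3, 2]} ∧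
      DEF = {u ∈ region | IsMorse (p u) ∧ passport (p u) = [3, 1, 4, 2]} ∧
      BDE = {u ∈ region | IsMorse (p u) ∧ passport (p u) = [2, 1, 4, 3]} ∧
      -- the degenerate snakes of the five separating arcs
      AF \ {ptA, F} = {u ∈ region | IsDegenerateSnake (p u) ∧ passport (p u) = [3, 2, 3, 1]} ∧
      OF \ {ptO, F} = {u ∈ region | IsDegenerateSnake (p u) ∧ passport (p u) = [3, 1, 2, 1]} ∧
      FD \ {F, ptD} = {u ∈ region | IsDegenerateSnake (p u) ∧ passport (p u) = [3, 1, 3, 2]} ∧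
      FE \ {F, ptE} = {u ∈ region | IsDegenerateSnake (p u) ∧ passport (p u) = [2, 1, 3, 1]} ∧
      ED \ {ptE, ptD} =
        {u ∈ region | IsDegenerateSnake (p u) ∧ passport (p u) = [2, 1, 3, 2]}) ∧
    -- these are all the snakes and all the degenerate snakes of order 4
    {a | ∃ P : ℝ[X], P.natDegree = 5 ∧ IsMorse P ∧ passport P = a} =
      {[4, 2, 3, 1], [3, 2, 4, 1], [4, 1, 3, 2], [3, 1, 4, 2], [2, 1, 4, 3]} ∧
    {a | ∃ P : ℝ[X], IsDegenerateSnake P ∧ passport P = a} =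
      {[3, 1, 3, 2], [3, 2, 3, 1], [3, 1, 2, 1], [2, 1, 3, 1], [2, 1, 3, 2]} := by
  refine ⟨fun _ => exists_normalization, fun _ => derivative_p, fun _ => discr_q, region_eq,
    fun _ => g_eq_zero_iff, fun _ => h_eq_zero_iff, fun _ => isMorse_p_iff_of_pos, ?_,
    setOf_passport_isMorse, setOf_passport_isDegenerateSnake⟩
  exact ⟨chart pointF, chart '' arcOA, chart '' arcAE, chart '' arcEB, chart '' arcAF,
    chart '' arcFD, chart '' arcOF, chart '' arcFE, chart '' arcED, chart '' cellOAF,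
    chart '' cellAEF, chart '' cellODF, chart '' cellDEF, chart '' cellBDE,
    setOf_g_eq_zero_and_h_eq_zero, abs_chart_pointF_sub_lt.1, abs_chart_pointF_sub_lt.2,
    isCurvilinearTriangle_region, setOf_dq_eq_zero, setOf_g_eq_zero, setOf_h_eq_zero,
    isCurvilinearTriangle_OAF, isCurvilinearTriangle_AEF, isCurvilinearTriangle_ODF,
    isCurvilinearTriangle_DEF, isCurvilinearTriangle_BDE, pairwise_disjoint_cells,
    setOf_g_ne_zero_and_h_ne_zero, image_chart_cellOAF, image_chart_cellAEF, image_chart_cellODF,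
    image_chart_cellDEF, image_chart_cellBDE, image_chart_arcAF_diff, image_chart_arcOF_diff,
    image_chart_arcFD_diff, image_chart_arcFE_diff, image_chart_arcED_diff⟩
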